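/- Let $k$ be a commutative ring. A \emph{prestack} $\mathcal C$ on a small category $\mathcal U$ is a pseudofunctor from $\mathcal U^{op}$ to $k$-linear categories: $k$-linear categories $\mathcal C(U)$, $k$-linear functors $u^*:\mathcal C(U)\to\mathcal C(V)$ for $u:V\to U$, and coherent natural isomorphisms $c^{u,v}:v^*u^*\cong(uv)^*$, $z^U:1\cong(1_U)^*$. Its descent category $\mathrm{Des}(\mathcal C)$ has as objects the families $(B_U)_U$, $B_U\in\mathcal C(U)$, with isomorphisms $\varphi_u:u^*B_U\cong B_V$ satisfying $\varphi_v v^*(\varphi_u)=\varphi_{uv}c^{u,v}$, and as morphisms the compatible families of morphisms; $\pi_U:\mathrm{Des}(\mathcal C)\to\mathcal C(U)$ denotes the projection. $\mathcal C$ is a \emph{prestack of affine localizations} if all $\mathcal C(U)$ are Grothendieck abelian categories, each $v^*$ is exact and has a fully faithful exact right adjoint $v_*$, and for each pullback square of $v:V\to U$ and $w:W\to U$ with diagonal $u:V\cap W\to U$ there are natural isomorphisms $v_*v^*w_*w^*\cong u_*u^*\cong w_*w^*v_*v^*$. A $k$-linear abelian category is \emph{flat over $k$} if for every finitely presented $k$-module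 $M$ the functor $\mathrm{Ext}^1_k(M,-)$ on it is effaceable (every object $C$ has a monomorphism $C\to C'$ with $\mathrm{Ext}^1_k(M,C)\to\mathrm{Ext}^1_k(M,C')$ zero); in the presence of enough injectives this means that every injective object $E$ is coflat, i.e. $\mathrm{Ext}^1_k(M,E)=0$ for all finitely presented $M$. Here, for $M=k^n/K$, $\mathrm{Ext}^1_k(M,C)$ is the cokernel of $\mathrm{Hom}_k(k^n,C)\to\mathrm{Hom}_k(K,C)$. For a prestack $\mathcal A$ of small $k$-linear categories, $\mathsf{Mod}_{\mathcal A}$ is the prestack $U\mapsto\mathsf{Mod}(\mathcal A(U))$ ($k$-linear functors $\mathcal A(U)^{op}\to\mathsf{Mod}(k)$) with restriction functors $-\otimes_u\mathcal A(V)$ and twists induced by those of $\mathcal A$, and $\mathsf{Qch}(\mathcal A)=\mathrm{Des}(\mathsf{Mod}_{\mathcal A})$. On a finite poset with binary meets, $\mathcal A$ is \emph{quasi-compact semi-separated} if $\mathsf{Mod}_{\mathcal A}$ is a prestack of affine localizations. \textbf{Proposition.} Let $\mathcal U$ be a finite poset with binary meets $U\cap V$, and let $\mathcal U^\star=\mathcal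 U\cup\{\star\}$ be $\mathcal U$ with a top element $\star$ adjoined. (A) Let $\mathcal C$ be a prestack of affine localizations on $\mathcal U$. (1) There is a prestack of affine localizations $\mathcal C^\star$ on $\mathcal U^\star$ with $\mathcal C^\star|_{\mathcal U}=\mathcal C$, $\mathcal C^\star(\star)=\mathrm{Des}(\mathcal C)$ and $u_U^*=\pi_U$ for $u_U:U\to\star$, namely the one whose twists $u^*\pi_U\cong\pi_V$ are given by the $\varphi_u$. For $U,V\in\mathcal U$, with $u^U_{U\cap V}:U\cap V\to U$ and $u^V_{U\cap V}:U\cap V\to V$, the right adjoint $u_{U,*}$ of $u_U^*$ satisfies base change: the canonical transformation $u_V^*u_{U,*}\to u^V_{U\cap V,*}\,u^{U,*}_{U\cap V}$ is an isomorphism. (2) If all the categories $\mathcal C(U)$, $U\in\mathcal U$, are flat over $k$, then so is $\mathrm{Des}(\mathcal C)$. (B) Let $\mathcal A$ be a quasi-compact semi-separated prestack on $\mathcal U$. (1) $\mathsf{Mod}_{\mathcal A}^\star$ is a prestack of affine localizations on $\mathcal U^\star$ with $\mathsf{Mod}_{\mathcal A}^\star|_{\mathcal U}=\mathsf{Mod}_{\mathcal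 A}$, and $\mathsf{Mod}_{\mathcal A}^\star(\star)=\mathsf{Qch}(\mathcal A)$ is a Grothendieck abelian category. (2) If all the modules $\mathcal A(U)(A,A')$, $U\in\mathcal U$, $A,A'\in\mathcal A(U)$, are flat over $k$, then $\mathsf{Qch}(\mathcal A)$ is flat over $k$. -/

import Mathlib

open CategoryTheory CategoryTheory.Limits

universe v u w w₁ w₂

set_option linter.checkUnivs false

/-! ### `k`-linear categories, prestacks and descent -/

/-- A `k`-linear category (bundled). -/
structure KLinCat (k : Type w) [CommRing k] where
  carrier : Type u
  [category : Category.{v} carrier]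
  [preadditive : Preadditive carrier]
  [linear : Linear k carrier]

instance {k : Type w} [CommRing k] : CoeSort (KLinCat.{v, u} k) (Type u) := ⟨KLinCat.carrier⟩

attribute [instance] KLinCat.category KLinCat.preadditive KLinCat.linear

/-- A prestack of `k`-linear categories on a category `X`: a pseudofunctor `Xᵒᵖ → k-linear
categories`. For `u : V ⟶ U` the restriction functor is `u^* = map u`; the twist
`c^{u,v} : v^* u^* ≅ (uv)^*` is `mapComp v u x h`, where `x` is any name for the composite
`v ≫ u : W ⟶ U`; the unit twist `z^U : 1 ≅ (1_U)^*` is `mapId U`. -/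
structure KPrestack (k : Type w) [CommRing k] (X : Type w₁) [Category.{w₂} X] where
  obj : X → KLinCat.{v, u} k
  map {V U : X} (u : V ⟶ U) : obj U ⥤ obj V
  map_additive {V U : X} (u : V ⟶ U) : (map u).Additive
  map_linear {V U : X} (u : V ⟶ U) : (map u).Linear k
  mapComp {W V U : X} (v : W ⟶ V) (u : V ⟶ U) (x : W ⟶ U) (h : v ≫ u = x) :
    map u ⋙ map v ≅ map x
  mapId (U : X) : 𝟭 (obj U) ≅ map (𝟙 U)
  assoc {T W V U : X} (w : T ⟶ W) (v : W ⟶ V) (u : V ⟶ U) (wv : T ⟶ V) (vu : W ⟶ U) (x : T ⟶ U)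
    (h₁ : w ≫ v = wv) (h₂ : v ≫ u = vu) (h₃ : w ≫ vu = x) (h₄ : wv ≫ u = x) (A : obj U) :
    (mapComp w v wv h₁).hom.app ((map u).obj A) ≫ (mapComp wv u x h₄).hom.app A =
      (map w).map ((mapComp v u vu h₂).hom.app A) ≫ (mapComp w vu x h₃).hom.app A
  mapId_comp {V U : X} (u : V ⟶ U) (A : obj U) :
    (mapId V).hom.app ((map u).obj A) ≫
      (mapComp (𝟙 V) u u (Category.id_comp u)).hom.app A = 𝟙 ((map u).obj A)
  comp_mapId {V U : X} (u : V ⟶ U) (A : obj U) :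
    (map u).map ((mapId U).hom.app A) ≫
      (mapComp u (𝟙 U) u (Category.comp_id u)).hom.app A = 𝟙 ((map u).obj A)

namespace KPrestack

attribute [instance] map_additive map_linear

variable {k : Type w} [CommRing k] {X : Type w₁} [Category.{w₂} X]

/-- A descent datum in a prestack `P`: objects `B_U` with isomorphisms `φ_u : u^* B_U ≅ B_V` such
that `φ_v ∘ v^*(φ_u) = φ_{uv} ∘ c^{u,v}`. -/
structure DescentDatum (P : KPrestack.{v, u} k X) where
  obj (U : X) : P.obj U
  iso {V U : X} (u : V ⟶ U) : (P.map u).obj (obj U) ≅ obj V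
  iso_comp {W V U : X} (v : W ⟶ V) (u : V ⟶ U) (x : W ⟶ U) (h : v ≫ u = x) :
    (P.map v).map (iso u).hom ≫ (iso v).hom = (P.mapComp v u x h).hom.app (obj U) ≫ (iso x).hom

variable {P : KPrestack.{v, u} k X}

namespace DescentDatum

/-- A morphism of descent data: compatible morphisms `g_U : B_U ⟶ B'_U`. -/
@[ext]
structure Hom (B B' : P.DescentDatum) where
  app (U : X) : B.obj U ⟶ B'.obj U
  comm {V U : X} (u : V ⟶ U) :
    (P.map u).map (app U) ≫ (B'.iso u).hom = (B.iso u).hom ≫ app V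

instance : Category P.DescentDatum where
  Hom := Hom
  id B := ⟨fun U => 𝟙 _, by simp⟩
  comp f g := ⟨fun U => f.app U ≫ g.app U, fun u => by
    rw [Functor.map_comp, Category.assoc, g.comm, reassoc_of% (f.comm u)]⟩

@[ext]
theorem hom_ext {B B' : P.DescentDatum} {f g : B ⟶ B'} (h : ∀ U, f.app U = g.app U) : f = g :=
  Hom.ext (funext h)

@[simp] theorem id_app (B : P.DescentDatum) (U : X) : Hom.app (𝟙 B) U = 𝟙 (B.obj U) := rfl

@[simp] theorem comp_app {B B' B'' : P.DescentDatum} (f : B ⟶ B') (g : B' ⟶ B'') (U : X) :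
    (f ≫ g).app U = f.app U ≫ g.app U := rfl

variable {B B' : P.DescentDatum}

instance : Zero (B ⟶ B') := ⟨⟨fun _ => 0, by simp⟩⟩

instance : Add (B ⟶ B') :=
  ⟨fun f g => ⟨fun U => f.app U + g.app U, fun u => by simp [f.comm, g.comm]⟩⟩

instance : Neg (B ⟶ B') := ⟨fun f => ⟨fun U => -f.app U, fun u => by simp [f.comm]⟩⟩

instance : Sub (B ⟶ B') :=
  ⟨fun f g => ⟨fun U => f.app U - g.app U, fun u => by simp [f.comm, g.comm]⟩⟩

instance : SMul k (B ⟶ B') :=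
  ⟨fun r f => ⟨fun U => r • f.app U, fun u => by simp [f.comm, Functor.map_smul]⟩⟩

@[simp] theorem zero_app (U : X) : Hom.app (0 : B ⟶ B') U = 0 := rfl

@[simp] theorem add_app (f g : B ⟶ B') (U : X) : (f + g).app U = f.app U + g.app U := rfl

@[simp] theorem neg_app (f : B ⟶ B') (U : X) : (-f).app U = -f.app U := rfl

@[simp] theorem sub_app (f g : B ⟶ B') (U : X) : (f - g).app U = f.app U - g.app U := rfl

@[simp] theorem smul_app (r : k) (f : B ⟶ B') (U : X) : (r • f).app U = r • f.app U := rfl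

instance : AddCommGroup (B ⟶ B') where
  add_assoc f g h := by ext U; simp [add_assoc]
  zero_add f := by ext U; simp
  add_zero f := by ext U; simp
  neg_add_cancel f := by ext U; simp
  add_comm f g := by ext U; simp [add_comm]
  sub_eq_add_neg f g := by ext U; simp [sub_eq_add_neg]
  nsmul := nsmulRec
  zsmul := zsmulRec

instance : Preadditive P.DescentDatum where
  add_comp _ _ _ _ _ _ := by ext U; simp
  comp_add _ _ _ _ _ _ := by ext U; simp

instance : Module k (B ⟶ B') where
  one_smul f := by ext U; simp
  mul_smul r s f := by ext U; simp [mul_smul]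
  smul_zero r := by ext U; simp
  smul_add r f g := by ext U; simp
  add_smul r s f := by ext U; simp [add_smul]
  zero_smul f := by ext U; simp

instance : Linear k P.DescentDatum where
  homModule _ _ := inferInstance
  smul_comp _ _ _ _ _ _ := by ext U; simp
  comp_smul _ _ _ _ _ _ := by ext U; simp

/-- The relation `φ_{1_U} ∘ z^U = 1` holds automatically in a descent datum. -/
theorem mapId_iso (B : P.DescentDatum) (U : X) :
    (P.mapId U).hom.app (B.obj U) ≫ (B.iso (𝟙 U)).hom = 𝟙 (B.obj U) := by
  have h₁ := B.iso_comp (𝟙 U) (𝟙 U) (𝟙 U) (Category.comp_id _)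
  rw [cancel_mono] at h₁
  have h₂ := P.comp_mapId (𝟙 U) (B.obj U)
  rw [← h₁, ← Functor.map_comp] at h₂
  have h₃ := (P.mapId U).hom.naturality
    ((P.mapId U).hom.app (B.obj U) ≫ (B.iso (𝟙 U)).hom)
  erw [h₂, Category.comp_id] at h₃
  exact (cancel_mono ((P.mapId U).hom.app (B.obj U))).1 (h₃.trans (Category.id_comp _).symm)

end DescentDatum

/-- The descent category `Des(P)`, as a `k`-linear category. -/
def Des (P : KPrestack.{v, u} k X) : KLinCat.{max w₁ v, max w₁ w₂ v u} k :=
  ⟨P.DescentDatum⟩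

/-- The canonical functor `π_U : Des(P) ⥤ P(U)`. -/
def proj (P : KPrestack.{v, u} k X) (U : X) : P.Des ⥤ P.obj U where
  obj B := DescentDatum.obj B U
  map f := DescentDatum.Hom.app f U

instance (P : KPrestack.{v, u} k X) (U : X) : (P.proj U).Additive where

instance (P : KPrestack.{v, u} k X) (U : X) : (P.proj U).Linear k where

/-- For `u : V ⟶ U`, the components `φ_u` form a natural isomorphism `u^* π_U ≅ π_V`. -/
def projComp (P : KPrestack.{v, u} k X) {V U : X} (u : V ⟶ U) : P.proj U ⋙ P.map u ≅ P.proj V :=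
  NatIso.ofComponents (fun B => DescentDatum.iso B u) fun f => DescentDatum.Hom.comm f u

end KPrestack

/-! ### Adjoining a top element -/

namespace KPrestack

section Star

variable {k : Type w} [CommRing k] {X : Type v} [PartialOrder X]

/-- The values of `C^⋆` on `X ∪ {⋆} = WithTop X`: `Des(C)` at the top, and `C(U)` at `U`. -/
def starObj (C : KPrestack.{v, max u v} k X) : WithTop X → KLinCat.{v, max u v} k
  | ⊤ => C.Des
  | (U : X) => C.obj U

/-- A morphism of `WithTop X` between elements of `X`, as a morphism of `X`. -/
def ofCoe {V U : X} (u : (V : WithTop X) ⟶ (U : WithTop X)) : V ⟶ U :=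
  homOfLE (WithTop.coe_le_coe.1 u.le)

/-- A morphism of `X`, as a morphism of `WithTop X`. -/
def toCoe {V U : X} (u : V ⟶ U) : (V : WithTop X) ⟶ (U : WithTop X) :=
  homOfLE (WithTop.coe_le_coe.2 u.le)

theorem not_top_hom {U : X} (u : (⊤ : WithTop X) ⟶ (U : WithTop X)) : False :=
  WithTop.not_top_le_coe U u.le

/-- The restriction functors of `C^⋆`: those of `C`, and the projections `π_U`. -/
def starMap (C : KPrestack.{v, max u v} k X) :
    {V U : WithTop X} → (V ⟶ U) → (C.starObj U ⥤ C.starObj V)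
  | ⊤, ⊤, _ => 𝟭 C.Des
  | (V : X), ⊤, _ => C.proj V
  | (_ : X), (_ : X), u => C.map (ofCoe u)
  | ⊤, (_ : X), u => (not_top_hom u).elim

/-- The twists of `C^⋆`: those of `C`, the isomorphisms `φ_u : u^* π_U ≅ π_V`, and identities. -/
def starMapComp (C : KPrestack.{v, max u v} k X) : {W V U : WithTop X} → (a : W ⟶ V) →
    (b : V ⟶ U) → (x : W ⟶ U) → C.starMap b ⋙ C.starMap a ≅ C.starMap x
  | ⊤, ⊤, ⊤, _, _, _ => Iso.refl _
  | (_ : X), ⊤, ⊤, _, _, _ => Iso.refl _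
  | (_ : X), (_ : X), ⊤, a, _, _ => C.projComp (ofCoe a)
  | (_ : X), (_ : X), (_ : X), a, b, x => C.mapComp (ofCoe a) (ofCoe b) (ofCoe x) rfl
  | ⊤, (_ : X), _, a, _, _ => (not_top_hom a).elim
  | _, ⊤, (_ : X), _, b, _ => (not_top_hom b).elim

def starMapId (C : KPrestack.{v, max u v} k X) : (U : WithTop X) →
    (𝟭 (C.starObj U) ≅ C.starMap (𝟙 U))
  | ⊤ => Iso.refl _
  | (U : X) => C.mapId U

/-- The extension `C^⋆` of a prestack `C` on a poset `X` to the poset `X ∪ {⋆}`, with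
`C^⋆(⋆) = Des(C)` and `u_U^* = π_U` for `u_U : U ⟶ ⋆`. -/
def star (C : KPrestack.{v, max u v} k X) : KPrestack.{v, max u v} k (WithTop X) where
  obj := C.starObj
  map := C.starMap
  map_additive {V U} u := match V, U, u with
    | ⊤, ⊤, _ => inferInstanceAs (𝟭 C.Des).Additive
    | (V : X), ⊤, _ => inferInstanceAs (C.proj V).Additive
    | (_ : X), (_ : X), u => inferInstanceAs (C.map (ofCoe u)).Additive
    | ⊤, (_ : X), u => (not_top_hom u).elim
  map_linear {V U} u := match V, U, u with
    | ⊤, ⊤, _ => inferInstanceAs ((𝟭 C.Des).Linear k)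
    | (V : X), ⊤, _ => inferInstanceAs ((C.proj V).Linear k)
    | (_ : X), (_ : X), u => inferInstanceAs ((C.map (ofCoe u)).Linear k)
    | ⊤, (_ : X), u => (not_top_hom u).elim
  mapComp a b x _ := C.starMapComp a b x
  mapId := C.starMapId
  assoc {T W V U} a b c ab bc x _ _ _ _ A := match T, W, V, U, a, b, c, ab, bc, x, A with
    | ⊤, ⊤, ⊤, ⊤, _, _, _, _, _, _, _ => rfl
    | (_ : X), ⊤, ⊤, ⊤, _, _, _, _, _, _, _ => rfl
    | (_ : X), (_ : X), ⊤, ⊤, a, _, _, _, _, _, A => by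
      change (DescentDatum.iso (P := C) A (ofCoe a)).hom ≫ 𝟙 _ =
        (C.map (ofCoe a)).map (𝟙 _) ≫ (DescentDatum.iso (P := C) A (ofCoe a)).hom
      rw [CategoryTheory.Functor.map_id, Category.id_comp, Category.comp_id]
    | (_ : X), (_ : X), (_ : X), ⊤, a, b, _, _, _, _, A =>
      (DescentDatum.iso_comp (P := C) A (ofCoe a) (ofCoe b) _ rfl).symm
    | (_ : X), (_ : X), (_ : X), (_ : X), a, b, c, _, _, _, A =>
      C.assoc (ofCoe a) (ofCoe b) (ofCoe c) _ _ _ rfl rfl rfl rfl A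
    | ⊤, (_ : X), _, _, a, _, _, _, _, _, _ => (not_top_hom a).elim
    | _, ⊤, (_ : X), _, _, b, _, _, _, _, _ => (not_top_hom b).elim
    | _, _, ⊤, (_ : X), _, _, c, _, _, _, _ => (not_top_hom c).elim
  mapId_comp {V U} u A := match V, U, u, A with
    | ⊤, ⊤, _, _ => Category.id_comp _
    | (V : X), ⊤, _, A => DescentDatum.mapId_iso (P := C) A V
    | (_ : X), (_ : X), u, A => C.mapId_comp (ofCoe u) A
    | ⊤, (_ : X), u, _ => (not_top_hom u).elim
  comp_mapId {V U} u A := match V, U, u, A with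
    | ⊤, ⊤, _, _ => Category.id_comp _
    | (V : X), ⊤, _, A => Category.id_comp _
    | (_ : X), (_ : X), u, A => C.comp_mapId (ofCoe u) A
    | ⊤, (_ : X), u, _ => (not_top_hom u).elim

/-- The restriction to `X` of a prestack on `X ∪ {⋆}`. -/
def restrict (D : KPrestack.{v, u} k (WithTop X)) : KPrestack.{v, u} k X where
  obj U := D.obj U
  map u := D.map (toCoe u)
  map_additive u := D.map_additive (toCoe u)
  map_linear u := D.map_linear (toCoe u)
  mapComp a b x _ := D.mapComp (toCoe a) (toCoe b) (toCoe x) rfl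
  mapId U := D.mapId U
  assoc _ _ _ _ _ _ _ _ _ _ A := D.assoc _ _ _ _ _ _ rfl rfl rfl rfl A
  mapId_comp u A := D.mapId_comp (toCoe u) A
  comp_mapId u A := D.comp_mapId (toCoe u) A

end Star

end KPrestack

/-! ### Grothendieck categories, exactness, flatness -/

/-- The category is a Grothendieck abelian category (for its given additive structure): abelian,
cocomplete, with exact filtered colimits and a generator. -/
def KLinCat.IsGrothendieck {k : Type w} [CommRing k] (C : KLinCat.{v, u} k) : Prop :=
  ∃ h : Abelian C, h.toPreadditive = C.preadditive ∧ IsGrothendieckAbelian.{v} C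

/-- Exactness of a functor: preservation of finite limits and of finite colimits. -/
def IsExactFunctor {C : Type*} [Category* C] {D : Type*} [Category* D] (F : C ⥤ D) : Prop :=
  PreservesFiniteLimits F ∧ PreservesFiniteColimits F

namespace KLinCat

variable {k : Type w} [CommRing k]

/-- An object `E` is coflat over `k` if `Hom_k(-, E)` is exact on finitely presented `k`-modules,
that is, if `Hom_k(k^n, E) ⟶ Hom_k(K, E)` is an epimorphism for every finitely generated
`K ≤ k^n`. Here the object `Hom_k(K, E)` is given by its generalized elements: a morphism
`T ⟶ Hom_k(K, E)` is a `k`-linear map `K → Hom(T, E)`, and surjectivity means that each such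
morphism lifts after composition with an epimorphism `T' ⟶ T`. -/
def IsCoflat (C : KLinCat.{v, u} k) (E : C) : Prop :=
  ∀ (n : ℕ) (K : Submodule k (Fin n → k)), K.FG → ∀ (T : C) (y : K →ₗ[k] (T ⟶ E)),
    ∃ (T' : C) (p : T' ⟶ T), Epi p ∧ ∃ x : (Fin n → k) →ₗ[k] (T' ⟶ E), ∀ a : K, x a = p ≫ y a

/-- Flatness over `k` of a `k`-linear abelian category `C`: for every finitely presented
`k`-module `M = k^n / K`, the functor `Ext¹_k(M, -) = coker (Hom_k(k^n, -) ⟶ Hom_k(K, -))` is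
effaceable, i.e. every object `A` has a monomorphism `i : A ⟶ A'` such that
`Ext¹_k(M, A) ⟶ Ext¹_k(M, A')` is zero. As in `IsCoflat`, the objects `Hom_k(K, -)` are given by
their generalized elements. -/
def IsFlat (C : KLinCat.{v, u} k) : Prop :=
  ∀ (n : ℕ) (K : Submodule k (Fin n → k)), K.FG → ∀ A : C, ∃ (A' : C) (i : A ⟶ A'), Mono i ∧
    ∀ (T : C) (y : K →ₗ[k] (T ⟶ A)), ∃ (T' : C) (p : T' ⟶ T), Epi p ∧
      ∃ x : (Fin n → k) →ₗ[k] (T' ⟶ A'), ∀ a : K, x a = p ≫ y a ≫ i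

/-- If `C` has enough injectives (e.g. if it is a Grothendieck category), then `C` is flat if and
only if every injective object is coflat. -/
theorem isFlat_iff (C : KLinCat.{v, u} k) [EnoughInjectives C] :
    C.IsFlat ↔ ∀ E : C, Injective E → C.IsCoflat E := by
  constructor
  · intro h E hE n K hK T y
    obtain ⟨A', i, hi, H⟩ := h n K hK E
    obtain ⟨T', p, hp, x, hx⟩ := H T y
    refine ⟨T', p, hp, (Linear.rightComp k T' (Injective.factorThru (𝟙 E) i)).comp x,
      fun a => ?_⟩
    simp [hx, Injective.comp_factorThru]
  · intro h n K hK A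
    refine ⟨Injective.under A, Injective.ι A, inferInstance, fun T y => ?_⟩
    obtain ⟨T', p, hp, x, hx⟩ := h (Injective.under A) inferInstance n K hK T
      ((Linear.rightComp k T (Injective.ι A)).comp y)
    exact ⟨T', p, hp, x, fun a => by simp [hx]⟩

end KLinCat

/-! ### Affine localizations and base change -/

namespace KPrestack

variable {k : Type w} [CommRing k] {X : Type w₁} [Category.{w₂} X]

/-- Prestacks of affine localizations: the categories are Grothendieck abelian, the restriction
functors `v^*` are exact with fully faithful exact right adjoints `v_*`, and for every pullback
square of `v` and `w` with diagonal `u`, `v_* v^* w_* w^* ≅ u_* u^* ≅ w_* w^* v_* v^*`. -/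
structure IsAffineLocalization (P : KPrestack.{v, u} k X) : Prop where
  grothendieck (U : X) : (P.obj U).IsGrothendieck
  exact {V U : X} (v : V ⟶ U) : IsExactFunctor (P.map v)
  rightAdjoint : ∃ R : ∀ {V U : X}, (V ⟶ U) → (P.obj V ⥤ P.obj U),
    (∀ {V U : X} (v : V ⟶ U), Nonempty (P.map v ⊣ R v) ∧ (R v).Full ∧ (R v).Faithful ∧
      IsExactFunctor (R v)) ∧
    ∀ {Q V W U : X} (w₁ : Q ⟶ V) (v₁ : Q ⟶ W) (v : V ⟶ U) (w : W ⟶ U),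
      IsPullback w₁ v₁ v w → ∀ u : Q ⟶ U, w₁ ≫ v = u →
      Nonempty ((P.map w ⋙ R w) ⋙ (P.map v ⋙ R v) ≅ P.map u ⋙ R u) ∧
      Nonempty ((P.map v ⋙ R v) ⋙ (P.map w ⋙ R w) ≅ P.map u ⋙ R u)

/-- The canonical base change transformation `w^* v_* ⟶ v₁_* w₁^*` of a commutative square
`w₁ ≫ v = v₁ ≫ w`, for right adjoints `v_*` of `v^*` and `v₁_*` of `v₁^*`: the mate of the
isomorphism `v₁^* w^* ≅ w₁^* v^*` given by the twists. -/
def baseChange (P : KPrestack.{v, u} k X) {Q V W U : X} {w₁ : Q ⟶ V} {v₁ : Q ⟶ W} {v : V ⟶ U}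
    {w : W ⟶ U} (sq : CommSq w₁ v₁ v w) {Rv : P.obj V ⥤ P.obj U} (adj : P.map v ⊣ Rv)
    {Rv₁ : P.obj Q ⥤ P.obj W} (adj₁ : P.map v₁ ⊣ Rv₁) : Rv ⋙ P.map w ⟶ P.map w₁ ⋙ Rv₁ :=
  (mateEquiv adj adj₁ (TwoSquare.mk (P.map w) (P.map v) (P.map v₁) (P.map w₁)
    ((P.mapComp v₁ w _ sq.w.symm).hom ≫ (P.mapComp w₁ v _ rfl).inv))).natTrans

end KPrestack

/-! ### Modules over prestacks of small `k`-linear categories -/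

section Modules

open scoped TensorProduct DirectSum

variable {k : Type v} [CommRing k]

/-- `k`-linear functors `aᵒᵖ ⥤ Mod(k)`. -/
def IsLinearPresheaf (a : KLinCat.{v, v} k) : ObjectProperty ((a : Type v)ᵒᵖ ⥤ ModuleCat.{v} k) :=
  fun F => ∀ ⦃A B : a⦄, (∀ f g : A ⟶ B, F.map (f + g).op = F.map f.op + F.map g.op) ∧
    ∀ (r : k) (f : A ⟶ B), F.map (r • f).op = r • F.map f.op

/-- The category of right modules over a small `k`-linear category `a`. -/
abbrev LinPsh (a : KLinCat.{v, v} k) : Type (v + 1) := (IsLinearPresheaf a).FullSubcategory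

/-- The category of right modules `Mod(a)`, as a `k`-linear category. -/
def KMod (a : KLinCat.{v, v} k) : KLinCat.{v, v + 1} k := ⟨LinPsh a⟩

namespace KMod

variable {a b : KLinCat.{v, v} k}

/-- Restriction of scalars `Mod(b) ⥤ Mod(a)`, `F ↦ F ∘ f`, along a `k`-linear functor
`f : a ⥤ b`. -/
def res (f : a ⥤ b) [f.Additive] [f.Linear k] : LinPsh b ⥤ LinPsh a :=
  (IsLinearPresheaf a).lift
    ((IsLinearPresheaf b).ι ⋙ (Functor.whiskeringLeft _ _ (ModuleCat.{v} k)).obj f.op) (by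
      intro F A B
      refine ⟨fun g h => ?_, fun r g => ?_⟩
      · change F.obj.map (f.map (g + h)).op = _
        rw [f.map_add]
        exact (F.property (A := f.obj A) (B := f.obj B)).1 _ _
      · change F.obj.map (f.map (r • g)).op = _
        rw [f.map_smul]
        exact (F.property (A := f.obj A) (B := f.obj B)).2 _ _)

variable (f : a ⥤ b)

/-- `⨁_A F(A) ⊗_k b(B, f A)`. -/
abbrev PreTensor (F : LinPsh a) (B : b) : Type v :=
  ⨁ A : a, (F.obj.obj (.op A) ⊗[k] (B ⟶ f.obj A))

open Classical in
/-- The element `x ⊗ y` of `⨁_A F(A) ⊗_k b(B, f A)`. -/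
noncomputable def preTmul (F : LinPsh a) (B : b) {A : a} (x : F.obj.obj (.op A))
    (y : B ⟶ f.obj A) : PreTensor f F B :=
  DirectSum.lof k a (fun A => F.obj.obj (.op A) ⊗[k] (B ⟶ f.obj A)) A (x ⊗ₜ[k] y)

/-- The relations `F(g)(x) ⊗ y ∼ x ⊗ f(g) y`. -/
def tensorRel (F : LinPsh a) (B : b) : Submodule k (PreTensor f F B) :=
  Submodule.span k {t | ∃ (A A' : a) (g : A ⟶ A') (x : F.obj.obj (.op A')) (y : B ⟶ f.obj A),
    t = preTmul f F B (F.obj.map g.op x) y - preTmul f F B x (y ≫ f.map g)}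

/-- `(F ⊗_f b)(B)`. -/
abbrev TensorAt (F : LinPsh a) (B : b) : Type v := PreTensor f F B ⧸ tensorRel f F B

/-- The class of `x ⊗ y` in `(F ⊗_f b)(B)`. -/
noncomputable def tmul (F : LinPsh a) (B : b) {A : a} (x : F.obj.obj (.op A)) (y : B ⟶ f.obj A) :
    TensorAt f F B :=
  (tensorRel f F B).mkQ (preTmul f F B x y)

theorem tmul_rel (F : LinPsh a) (B : b) {A A' : a} (g : A ⟶ A') (x : F.obj.obj (.op A'))
    (y : B ⟶ f.obj A) : tmul f F B (F.obj.map g.op x) y = tmul f F B x (y ≫ f.map g) := by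
  rw [tmul, tmul, ← sub_eq_zero, ← map_sub]
  exact (Submodule.Quotient.mk_eq_zero _).2 (Submodule.subset_span ⟨A, A', g, x, y, rfl⟩)

/-- Maps out of `(F ⊗_f b)(B)`. -/
noncomputable def tensorLift (F : LinPsh a) (B : b) {M : Type v} [AddCommGroup M] [Module k M]
    (φ : ∀ A : a, F.obj.obj (.op A) →ₗ[k] (B ⟶ f.obj A) →ₗ[k] M)
    (h : ∀ (A A' : a) (g : A ⟶ A') (x : F.obj.obj (.op A')) (y : B ⟶ f.obj A),
      φ A (F.obj.map g.op x) y = φ A' x (y ≫ f.map g)) : TensorAt f F B →ₗ[k] M :=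
  open Classical in
  (tensorRel f F B).liftQ (DirectSum.toModule k a M fun A => TensorProduct.lift (φ A)) (by
    rw [tensorRel, Submodule.span_le]
    rintro _ ⟨A, A', g, x, y, rfl⟩
    simp [preTmul, h])

@[simp] theorem tensorLift_tmul (F : LinPsh a) (B : b) {M : Type v} [AddCommGroup M] [Module k M]
    (φ : ∀ A : a, F.obj.obj (.op A) →ₗ[k] (B ⟶ f.obj A) →ₗ[k] M) (h) {A : a}
    (x : F.obj.obj (.op A)) (y : B ⟶ f.obj A) :
    tensorLift f F B φ h (tmul f F B x y) = φ A x y := by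
  simp [tensorLift, tmul, preTmul]

theorem tensor_ext {F : LinPsh a} {B : b} {M : Type v} [AddCommGroup M] [Module k M]
    {φ ψ : TensorAt f F B →ₗ[k] M}
    (h : ∀ (A : a) (x : F.obj.obj (.op A)) (y : B ⟶ f.obj A),
      φ (tmul f F B x y) = ψ (tmul f F B x y)) : φ = ψ := by
  classical
  refine Submodule.linearMap_qext _ (DirectSum.linearMap_ext k fun A => ?_)
  exact TensorProduct.ext' (h A)

/-- The bilinear map `(x, y) ↦ x ⊗ y`. -/
noncomputable def tmulₗ (F : LinPsh a) (B : b) (A : a) :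
    F.obj.obj (.op A) →ₗ[k] (B ⟶ f.obj A) →ₗ[k] TensorAt f F B :=
  open Classical in
  (TensorProduct.mk k _ _).compr₂ ((tensorRel f F B).mkQ ∘ₗ
    DirectSum.lof k a (fun A => F.obj.obj (.op A) ⊗[k] (B ⟶ f.obj A)) A)

theorem tmulₗ_apply (F : LinPsh a) (B : b) (A : a) (x : F.obj.obj (.op A))
    (y : B ⟶ f.obj A) : tmulₗ f F B A x y = tmul f F B x y := rfl

theorem tmul_add (F : LinPsh a) (B : b) {A : a} (x : F.obj.obj (.op A)) (y y' : B ⟶ f.obj A) :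
    tmul f F B x (y + y') = tmul f F B x y + tmul f F B x y' :=
  map_add (tmulₗ f F B A x) y y'

theorem tmul_smul (F : LinPsh a) (B : b) {A : a} (x : F.obj.obj (.op A)) (r : k)
    (y : B ⟶ f.obj A) : tmul f F B x (r • y) = r • tmul f F B x y :=
  map_smul (tmulₗ f F B A x) r y

/-- The action of `β : B' ⟶ B` on `F ⊗_f b`: `x ⊗ y ↦ x ⊗ yβ`. -/
noncomputable def tensorMap (F : LinPsh a) {B B' : b} (β : B' ⟶ B) :
    TensorAt f F B →ₗ[k] TensorAt f F B' :=
  tensorLift f F B (fun A => (tmulₗ f F B' A).compl₂ (Linear.leftComp k (f.obj A) β)) (by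
    intro A A' g x y
    simp [tmulₗ_apply, tmul_rel])

@[simp] theorem tensorMap_tmul (F : LinPsh a) {B B' : b} (β : B' ⟶ B) {A : a}
    (x : F.obj.obj (.op A)) (y : B ⟶ f.obj A) :
    tensorMap f F β (tmul f F B x y) = tmul f F B' x (β ≫ y) := by
  simp [tensorMap, tmulₗ_apply]

/-- The module `F ⊗_f b`. -/
noncomputable def tensorObj (F : LinPsh a) : LinPsh b where
  obj :=
    { obj := fun B => ModuleCat.of k (TensorAt f F B.unop)
      map := fun β => ModuleCat.ofHom (tensorMap f F β.unop)
      map_id := fun B => by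
        ext : 1
        exact tensor_ext f fun A x y => by simp
      map_comp := fun β γ => by
        ext : 1
        exact tensor_ext f fun A x y => by simp }
  property A B := ⟨fun g h => by
      ext : 1
      refine tensor_ext f fun A x y => ?_
      change tensorMap f F (g + h) _ = tensorMap f F g _ + tensorMap f F h _
      simp only [tensorMap_tmul, Preadditive.add_comp, tmul_add],
    fun r g => by
      ext : 1
      refine tensor_ext f fun A x y => ?_
      change tensorMap f F (r • g) _ = r • tensorMap f F g _
      simp only [tensorMap_tmul, Linear.smul_comp, tmul_smul]⟩

variable [f.Additive] [f.Linear k]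

/-- The bilinear map `(x, y) ↦ G(y)(h x)`. -/
noncomputable def evalₗ {F : LinPsh a} {G : LinPsh b} (h : F ⟶ (res f).obj G) (B : b) (A : a) :
    F.obj.obj (.op A) →ₗ[k] (B ⟶ f.obj A) →ₗ[k] G.obj.obj (.op B) :=
  LinearMap.mk₂ k (fun x y => G.obj.map y.op (h.hom.app (.op A) x))
    (fun x x' y => by
      have := map_add (h.hom.app (.op A)).hom x x'
      exact (congrArg (G.obj.map y.op) this).trans (map_add (G.obj.map y.op).hom _ _))
    (fun r x y => by
      have := map_smul (h.hom.app (.op A)).hom r x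
      exact (congrArg (G.obj.map y.op) this).trans (map_smul (G.obj.map y.op).hom _ _))
    (fun x y y' => by
      rw [(G.property (A := B) (B := f.obj A)).1]; rfl)
    (fun r x y => by
      rw [(G.property (A := B) (B := f.obj A)).2]; rfl)

theorem evalₗ_rel {F : LinPsh a} {G : LinPsh b} (h : F ⟶ (res f).obj G) (B : b) (A A' : a)
    (u : A ⟶ A') (x : F.obj.obj (.op A')) (y : B ⟶ f.obj A) :
    evalₗ f h B A (F.obj.map u.op x) y = evalₗ f h B A' x (y ≫ f.map u) := by
  have H := congrArg (fun φ => φ.hom x) (h.hom.naturality u.op)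
  change (h.hom.app _).hom (F.obj.map u.op x) = G.obj.map (f.map u).op _ at H
  change G.obj.map y.op ((h.hom.app _).hom (F.obj.map u.op x)) = G.obj.map (y ≫ f.map u).op _
  rw [H, op_comp, G.obj.map_comp]
  rfl

/-- The universal property of `F ⊗_f b`. -/
noncomputable def tensorHomEquiv (F : LinPsh a) (G : LinPsh b) :
    (tensorObj f F ⟶ G) ≃ (F ⟶ (res f).obj G) where
  toFun g := ObjectProperty.homMk
    { app := fun A => ModuleCat.ofHom
        ((g.hom.app (.op (f.obj A.unop))).hom ∘ₗ (tmulₗ f F (f.obj A.unop) A.unop).flip (𝟙 _))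
      naturality := fun A A' u => by
        ext x
        have h := congrArg (fun φ => φ.hom (tmul f F (f.obj A.unop) x (𝟙 _)))
          (g.hom.naturality (f.map u.unop).op)
        change (g.hom.app _).hom (tensorMap f F (f.map u.unop) _) = _ at h
        rw [tensorMap_tmul, Category.comp_id] at h
        change (g.hom.app _).hom (tmul f F _ (F.obj.map u.unop.op x) (𝟙 _)) = _
        rw [tmul_rel, Category.id_comp, h]
        rfl }
  invFun h := ObjectProperty.homMk
    { app := fun B => ModuleCat.ofHom
        (tensorLift f F B.unop (evalₗ f h B.unop) (evalₗ_rel f h B.unop))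
      naturality := fun B B' u => by
        ext : 1
        refine tensor_ext f fun A x y => ?_
        change tensorLift f F _ (evalₗ f h _) (evalₗ_rel f h _) (tensorMap f F u.unop _) =
          G.obj.map u (tensorLift f F _ (evalₗ f h _) (evalₗ_rel f h _) _)
        rw [tensorMap_tmul, tensorLift_tmul, tensorLift_tmul]
        change G.obj.map (u.unop ≫ y).op _ = G.obj.map u (G.obj.map y.op _)
        rw [op_comp, G.obj.map_comp]
        rfl }
  left_inv g := by
    ext B : 4
    refine tensor_ext f fun A x y => ?_
    refine (tensorLift_tmul f F _ (evalₗ f _ _) (evalₗ_rel f _ _) x y).trans ?_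
    have h := congrArg (fun φ => φ.hom (tmul f F (f.obj A) x (𝟙 _))) (g.hom.naturality y.op)
    change (g.hom.app _).hom (tensorMap f F y _) = _ at h
    rw [tensorMap_tmul, Category.comp_id] at h
    exact h.symm
  right_inv h := by
    ext A x
    refine (tensorLift_tmul f F _ (evalₗ f h _) (evalₗ_rel f h _) x (𝟙 _)).trans ?_
    change G.obj.map (𝟙 _) _ = _
    rw [G.obj.map_id]
    rfl

/-- The functor `- ⊗_f b : Mod(a) ⥤ Mod(b)`. -/
noncomputable def tensor : LinPsh a ⥤ LinPsh b :=
  Adjunction.leftAdjointOfEquiv (tensorHomEquiv f) (by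
    intro F G G' g h
    rfl)

/-- `- ⊗_f b` is left adjoint to restriction of scalars along `f`. -/
noncomputable def tensorAdj : tensor f ⊣ res f :=
  Adjunction.adjunctionOfEquivLeft (tensorHomEquiv f) _

theorem tensor_map_tmul {F F' : LinPsh a} (g : F ⟶ F') (B : b) {A : a} (x : F.obj.obj (.op A))
    (y : B ⟶ f.obj A) :
    ((tensor f).map g).hom.app (.op B) (tmul f F B x y) =
      tmul f F' B (g.hom.app (.op A) x) y := by
  refine (tensorLift_tmul f F _ (evalₗ f _ _) (evalₗ_rel f _ _) x y).trans ?_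
  refine (tensorMap_tmul f F' y _ _).trans ?_
  rw [Category.comp_id]
  rfl

instance : (tensor f).Additive where
  map_add {F F' g g'} := by
    ext B : 4
    refine tensor_ext f fun A x y => ?_
    refine (tensor_map_tmul f (g + g') B.unop x y).trans ?_
    change tmulₗ f F' _ A (g.hom.app _ x + g'.hom.app _ x) y = _
    rw [map_add]
    exact congrArg₂ (· + ·) (tensor_map_tmul f g B.unop x y).symm
      (tensor_map_tmul f g' B.unop x y).symm

instance : (tensor f).Linear k where
  map_smul {F F'} g r := by
    ext B : 4
    refine tensor_ext f fun A x y => ?_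
    refine (tensor_map_tmul f (r • g) B.unop x y).trans ?_
    change tmulₗ f F' _ A (r • g.hom.app _ x) y = _
    rw [map_smul]
    exact congrArg (r • ·) (tensor_map_tmul f g B.unop x y).symm

/-- The functor `- ⊗_f b`, between `k`-linear categories. -/
noncomputable def ext : KMod a ⥤ KMod b := tensor f

/-- Restriction of scalars, between `k`-linear categories. -/
def scalarRes : KMod b ⥤ KMod a := res f

/-- `- ⊗_f b` is left adjoint to restriction of scalars. -/
noncomputable def extAdj : ext f ⊣ scalarRes f := tensorAdj f

instance : (ext f).Additive := inferInstanceAs (tensor f).Additive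

instance : (ext f).Linear k := inferInstanceAs ((tensor f).Linear k)

/-- A natural isomorphism `α : g ∘ f ≅ h` induces `F ∘ h ≅ (F ∘ g) ∘ f` on restrictions of
scalars. -/
def resComp {a b c : KLinCat.{v, v} k} (f : a ⥤ b) (g : b ⥤ c) (h : a ⥤ c) [f.Additive]
    [f.Linear k] [g.Additive] [g.Linear k] [h.Additive] [h.Linear k] (α : f ⋙ g ≅ h) :
    scalarRes h ≅ scalarRes g ⋙ scalarRes f :=
  NatIso.ofComponents
    (fun F => ObjectProperty.isoMk _ (NatIso.ofComponents
      (fun A => F.obj.mapIso (α.app A.unop).op)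
      (fun u => by
        change F.obj.map _ ≫ F.obj.map _ = F.obj.map _ ≫ F.obj.map _
        rw [← F.obj.map_comp, ← F.obj.map_comp]
        exact congrArg (fun t => F.obj.map t.op) (α.hom.naturality u.unop).symm)))
    (fun {F G} g => by
      apply ObjectProperty.hom_ext
      ext A : 2
      exact (g.hom.naturality (α.hom.app A.unop).op).symm)

/-- A natural isomorphism `α : 1 ≅ f` induces `F ∘ f ≅ F` on restrictions of scalars. -/
def resId (f : a ⥤ a) [f.Additive] [f.Linear k] (α : 𝟭 a ≅ f) : scalarRes f ≅ 𝟭 (KMod a) :=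
  NatIso.ofComponents
    (fun F => ObjectProperty.isoMk _ (NatIso.ofComponents
      (fun A => F.obj.mapIso (α.app A.unop).op)
      (fun u => by
        change F.obj.map _ ≫ F.obj.map _ = F.obj.map _ ≫ F.obj.map _
        rw [← F.obj.map_comp, ← F.obj.map_comp]
        exact congrArg (fun t => F.obj.map t.op) (α.hom.naturality u.unop).symm)))
    (fun {F G} g => by
      apply ObjectProperty.hom_ext
      ext A : 2
      exact (g.hom.naturality (α.hom.app A.unop).op).symm)

end KMod

section Conjugates

open Functor

variable {A B C D : Type*} [Category* A] [Category* B] [Category* C] [Category* D]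

theorem conjugate_assoc {U : A ⥤ B} {V : B ⥤ C} {W : C ⥤ D} {VU : A ⥤ C} {WV : B ⥤ D}
    {Y : A ⥤ D} {U' : B ⥤ A} {V' : C ⥤ B} {W' : D ⥤ C} {VU' : C ⥤ A} {WV' : D ⥤ B} {Y' : D ⥤ A}
    (hU : U ⊣ U') (hV : V ⊣ V') (hW : W ⊣ W') (hVU : VU ⊣ VU') (hWV : WV ⊣ WV') (hY : Y ⊣ Y')
    (r₁ : WV' ≅ W' ⋙ V') (r₂ : Y' ≅ WV' ⋙ U') (r₃ : VU' ≅ V' ⋙ U') (r₄ : Y' ≅ W' ⋙ VU')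
    (h : ∀ d, r₂.hom.app d ≫ U'.map (r₁.hom.app d) = r₄.hom.app d ≫ r₃.hom.app (W'.obj d))
    (a : A) :
    ((conjugateIsoEquiv hWV (hV.comp hW)).symm r₁).hom.app (U.obj a) ≫
        ((conjugateIsoEquiv hY (hU.comp hWV)).symm r₂).hom.app a =
      W.map (((conjugateIsoEquiv hVU (hU.comp hV)).symm r₃).hom.app a) ≫
        ((conjugateIsoEquiv hY (hVU.comp hW)).symm r₄).hom.app a := by
  have key : (associator U V W).hom ≫
      whiskerLeft U ((conjugateEquiv hWV (hV.comp hW)).symm r₁.hom) ≫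
        (conjugateEquiv hY (hU.comp hWV)).symm r₂.hom =
      whiskerRight ((conjugateEquiv hVU (hU.comp hV)).symm r₃.hom) W ≫
        (conjugateEquiv hY (hVU.comp hW)).symm r₄.hom := by
    apply (conjugateEquiv hY ((hU.comp hV).comp hW)).injective
    rw [← conjugateEquiv_comp hY (hU.comp (hV.comp hW)), ← conjugateEquiv_comp hY (hU.comp hWV),
      ← conjugateEquiv_comp hY (hVU.comp hW), conjugateEquiv_associator_hom,
      conjugateEquiv_whiskerLeft, conjugateEquiv_whiskerRight]
    ext d
    simpa using h d
  simpa using congr_app key a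

theorem conjugate_id_comp {U : A ⥤ B} {I : B ⥤ B} {U' : B ⥤ A} {I' : B ⥤ B} (hU : U ⊣ U')
    (hI : I ⊣ I') (z : I' ≅ 𝟭 B) (r : U' ≅ I' ⋙ U')
    (h : ∀ d, r.hom.app d ≫ U'.map (z.hom.app d) = 𝟙 _) (a : A) :
    ((conjugateIsoEquiv hI Adjunction.id).symm z).hom.app (U.obj a) ≫
      ((conjugateIsoEquiv hU (hU.comp hI)).symm r).hom.app a = 𝟙 _ := by
  have key : whiskerLeft U ((conjugateEquiv hI Adjunction.id).symm z.hom) ≫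
      (conjugateEquiv hU (hU.comp hI)).symm r.hom = (rightUnitor U).hom := by
    apply (conjugateEquiv hU (hU.comp Adjunction.id)).injective
    rw [← conjugateEquiv_comp hU (hU.comp hI), conjugateEquiv_whiskerLeft,
      conjugateEquiv_rightUnitor_hom]
    ext d
    simpa using h d
  simpa using congr_app key a

theorem conjugate_comp_id {U : A ⥤ B} {I : A ⥤ A} {U' : B ⥤ A} {I' : A ⥤ A} (hU : U ⊣ U')
    (hI : I ⊣ I') (z : I' ≅ 𝟭 A) (r : U' ≅ U' ⋙ I')
    (h : ∀ d, r.hom.app d ≫ z.hom.app (U'.obj d) = 𝟙 _) (a : A) :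
    U.map (((conjugateIsoEquiv hI Adjunction.id).symm z).hom.app a) ≫
      ((conjugateIsoEquiv hU (hI.comp hU)).symm r).hom.app a = 𝟙 _ := by
  have key : whiskerRight ((conjugateEquiv hI Adjunction.id).symm z.hom) U ≫
      (conjugateEquiv hU (hI.comp hU)).symm r.hom = (leftUnitor U).hom := by
    apply (conjugateEquiv hU (Adjunction.id.comp hU)).injective
    rw [← conjugateEquiv_comp hU (hI.comp hU), conjugateEquiv_whiskerRight,
      conjugateEquiv_leftUnitor_hom]
    ext d
    simpa using h d
  simpa using congr_app key a

end Conjugates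

namespace KPrestack

variable {X : Type w₁} [Category.{w₂} X]

/-- The twist `- ⊗_u A(V) ⊗_v A(W) ≅ - ⊗_{uv} A(W)` of `Mod_A`: the conjugate of the isomorphism
of restrictions of scalars induced by the twist of `A`. -/
noncomputable def modMapComp (A : KPrestack.{v, v} k X) {W V U : X} (v : W ⟶ V) (u : V ⟶ U)
    (x : W ⟶ U) (h : v ≫ u = x) :
    KMod.ext (A.map u) ⋙ KMod.ext (A.map v) ≅ KMod.ext (A.map x) :=
  (conjugateIsoEquiv (KMod.extAdj (A.map x))
    ((KMod.extAdj (A.map u)).comp (KMod.extAdj (A.map v)))).symm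
      (KMod.resComp (A.map u) (A.map v) (A.map x) (A.mapComp v u x h))

/-- The unit twist `1 ≅ - ⊗_{1_U} A(U)` of `Mod_A`. -/
noncomputable def modMapId (A : KPrestack.{v, v} k X) (U : X) :
    𝟭 (KMod (A.obj U)) ≅ KMod.ext (A.map (𝟙 U)) :=
  (conjugateIsoEquiv (KMod.extAdj (A.map (𝟙 U))) Adjunction.id).symm
    (KMod.resId (A.map (𝟙 U)) (A.mapId U))

theorem mod_assoc (A : KPrestack.{v, v} k X) {T W V U : X} (w : T ⟶ W) (v : W ⟶ V) (u : V ⟶ U)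
    (wv : T ⟶ V) (vu : W ⟶ U) (x : T ⟶ U) (h₁ : w ≫ v = wv) (h₂ : v ≫ u = vu)
    (h₃ : w ≫ vu = x) (h₄ : wv ≫ u = x) (F : KMod (A.obj U)) :
    (A.modMapComp w v wv h₁).hom.app ((KMod.ext (A.map u)).obj F) ≫
        (A.modMapComp wv u x h₄).hom.app F =
      (KMod.ext (A.map w)).map ((A.modMapComp v u vu h₂).hom.app F) ≫
        (A.modMapComp w vu x h₃).hom.app F := by
  refine conjugate_assoc (KMod.extAdj (A.map u)) (KMod.extAdj (A.map v))
    (KMod.extAdj (A.map w)) (KMod.extAdj (A.map vu)) (KMod.extAdj (A.map wv))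
    (KMod.extAdj (A.map x)) _ _ _ _ (fun d => ?_) F
  apply ObjectProperty.hom_ext
  ext B : 2
  change d.obj.map _ ≫ d.obj.map _ = d.obj.map _ ≫ d.obj.map _
  rw [← d.obj.map_comp, ← d.obj.map_comp]
  exact congrArg (fun t => d.obj.map t.op) (A.assoc w v u wv vu x h₁ h₂ h₃ h₄ B.unop)

theorem mod_mapId_comp (A : KPrestack.{v, v} k X) {V U : X} (u : V ⟶ U) (F : KMod (A.obj U)) :
    (A.modMapId V).hom.app ((KMod.ext (A.map u)).obj F) ≫
      (A.modMapComp (𝟙 V) u u (Category.id_comp u)).hom.app F = 𝟙 _ := by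
  refine conjugate_id_comp (KMod.extAdj (A.map u)) (KMod.extAdj (A.map (𝟙 V))) _ _
    (fun d => ?_) F
  apply ObjectProperty.hom_ext
  ext B : 2
  change d.obj.map _ ≫ d.obj.map _ = 𝟙 (d.obj.obj _)
  rw [← d.obj.map_comp, ← d.obj.map_id]
  exact congrArg (fun t => d.obj.map t.op) (A.mapId_comp u B.unop)

theorem mod_comp_mapId (A : KPrestack.{v, v} k X) {V U : X} (u : V ⟶ U) (F : KMod (A.obj U)) :
    (KMod.ext (A.map u)).map ((A.modMapId U).hom.app F) ≫
      (A.modMapComp u (𝟙 U) u (Category.comp_id u)).hom.app F = 𝟙 _ := by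
  refine conjugate_comp_id (KMod.extAdj (A.map u)) (KMod.extAdj (A.map (𝟙 U))) _ _
    (fun d => ?_) F
  apply ObjectProperty.hom_ext
  ext B : 2
  change d.obj.map _ ≫ d.obj.map _ = 𝟙 (d.obj.obj _)
  rw [← d.obj.map_comp, ← d.obj.map_id]
  exact congrArg (fun t => d.obj.map t.op) (A.comp_mapId u B.unop)

/-- The prestack `Mod_A` of a prestack `A` of small `k`-linear categories: `U ↦ Mod(A(U))` with
restriction functors `- ⊗_u A(V)`. -/
noncomputable def mod (A : KPrestack.{v, v} k X) : KPrestack.{v, v + 1} k X where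
  obj U := KMod (A.obj U)
  map u := KMod.ext (A.map u)
  map_additive u := inferInstanceAs (KMod.ext (A.map u)).Additive
  map_linear u := inferInstanceAs ((KMod.ext (A.map u)).Linear k)
  mapComp := A.modMapComp
  mapId := A.modMapId
  assoc := A.mod_assoc
  mapId_comp := A.mod_mapId_comp
  comp_mapId := A.mod_comp_mapId

/-- The category `Qch(A) = Des(Mod_A)` of quasi-coherent (right) modules over `A`. -/
noncomputable def Qch (A : KPrestack.{v, v} k X) : KLinCat.{max w₁ v, max w₁ w₂ (v + 1)} k :=
  A.mod.Des

/-- Semi-separated prestacks; on a finite poset, these are the quasi-compact semi-separated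
prestacks. -/
def IsSemiSeparated (A : KPrestack.{v, v} k X) : Prop := A.mod.IsAffineLocalization

end KPrestack

end Modules

universe v₃ u₃ u'

namespace KPrestack

variable {k : Type w} [CommRing k] {X : Type w₁} [Category.{w₂} X] {P : KPrestack.{v, u} k X}

namespace Des

theorem hom_ext {B B' : P.Des} {f g : B ⟶ B'}
    (h : ∀ U, (P.proj U).map f = (P.proj U).map g) : f = g :=
  DescentDatum.hom_ext h

/-- A compatible family of morphisms is a morphism of descent data. -/
def homMk {B B' : P.Des} (f : ∀ U, (P.proj U).obj B ⟶ (P.proj U).obj B')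
    (h : ∀ {V U : X} (u : V ⟶ U), (P.map u).map (f U) ≫ (P.projComp u).hom.app B' =
      (P.projComp u).hom.app B ≫ f V) : B ⟶ B' :=
  ⟨f, h⟩

theorem map_proj_map {B B' : P.Des} (f : B ⟶ B') {V U : X} (u : V ⟶ U) :
    (P.map u).map ((P.proj U).map f) ≫ (P.projComp u).hom.app B' =
      (P.projComp u).hom.app B ≫ (P.proj V).map f :=
  (P.projComp u).hom.naturality f

theorem map_proj_map_assoc {B B' : P.Des} (f : B ⟶ B') {V U : X} (u : V ⟶ U) {Z : P.obj V}
    (g : (P.proj V).obj B' ⟶ Z) :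
    (P.map u).map ((P.proj U).map f) ≫ (P.projComp u).hom.app B' ≫ g =
      (P.projComp u).hom.app B ≫ (P.proj V).map f ≫ g := by
  rw [← Category.assoc, map_proj_map, Category.assoc]

theorem projComp_comp (B : P.Des) {W V U : X} (v : W ⟶ V) (u : V ⟶ U) (x : W ⟶ U)
    (h : v ≫ u = x) : (P.map v).map ((P.projComp u).hom.app B) ≫ (P.projComp v).hom.app B =
      (P.mapComp v u x h).hom.app ((P.proj U).obj B) ≫ (P.projComp x).hom.app B :=
  DescentDatum.iso_comp (P := P) B v u x h

/-- A family of objects with coherent isomorphisms is an object of `Des(P)`. -/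
def mk (obj : ∀ U, P.obj U) (iso : ∀ {V U : X} (u : V ⟶ U), (P.map u).obj (obj U) ≅ obj V)
    (h : ∀ {W V U : X} (v : W ⟶ V) (u : V ⟶ U) (x : W ⟶ U) (h : v ≫ u = x),
      (P.map v).map (iso u).hom ≫ (iso v).hom =
        (P.mapComp v u x h).hom.app (obj U) ≫ (iso x).hom) : P.Des :=
  ⟨obj, iso, h⟩

/-- An isomorphism of descent data from a family of isomorphisms. -/
def isoMk {B B' : P.Des} (e : ∀ U, (P.proj U).obj B ≅ (P.proj U).obj B')
    (h : ∀ {V U : X} (u : V ⟶ U), (P.map u).map (e U).hom ≫ (P.projComp u).hom.app B' =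
      (P.projComp u).hom.app B ≫ (e V).hom) : B ≅ B' where
  hom := homMk (fun U => (e U).hom) h
  inv := homMk (fun U => (e U).inv) fun {V U} u => by
    rw [← cancel_mono (e V).hom, Category.assoc, ← h u, ← Functor.map_comp_assoc]
    simp
  hom_inv_id := hom_ext fun U => (e U).hom_inv_id
  inv_hom_id := hom_ext fun U => (e U).inv_hom_id

section Limits

variable {J : Type u₃} [Category.{v₃} J]

/-- A cocone in `Des(P)` is a colimit if all its projections are. -/
def isColimitOfProj {F : J ⥤ P.Des} (c : Cocone F)
    (hc : ∀ U, IsColimit ((P.proj U).mapCocone c))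
    [∀ {V U : X} (u : V ⟶ U), PreservesColimitsOfShape J (P.map u)] : IsColimit c where
  desc s := homMk (fun U => (hc U).desc ((P.proj U).mapCocone s)) fun {V U} u => by
    refine (isColimitOfPreserves (P.map u) (hc U)).hom_ext fun j => ?_
    have h₁ := (hc U).fac ((P.proj U).mapCocone s) j
    have h₂ := (hc V).fac ((P.proj V).mapCocone s) j
    simp only [Functor.mapCocone_ι_app, Functor.comp_obj,
      Functor.mapCocone_pt] at h₁ h₂ ⊢
    rw [← Functor.map_comp_assoc, h₁, map_proj_map, map_proj_map_assoc, h₂]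
  fac s j := hom_ext fun U => (hc U).fac ((P.proj U).mapCocone s) j
  uniq s m hm := hom_ext fun U => (hc U).uniq ((P.proj U).mapCocone s) _ fun j =>
    ((P.proj U).map_comp _ _).symm.trans (congrArg _ (hm j))

/-- A cone in `Des(P)` is a limit if all its projections are. -/
def isLimitOfProj {F : J ⥤ P.Des} (c : Cone F)
    (hc : ∀ U, IsLimit ((P.proj U).mapCone c)) : IsLimit c where
  lift s := homMk (fun U => (hc U).lift ((P.proj U).mapCone s)) fun {V U} u => by
    refine (hc V).hom_ext fun j => ?_
    have h₁ := (hc U).fac ((P.proj U).mapCone s) j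
    have h₂ := (hc V).fac ((P.proj V).mapCone s) j
    simp only [Functor.mapCone_π_app, Functor.comp_obj,
      Functor.mapCone_pt] at h₁ h₂ ⊢
    rw [Category.assoc, Category.assoc, h₂, ← map_proj_map, ← map_proj_map,
      ← Functor.map_comp_assoc, h₁]
  fac s j := hom_ext fun U => (hc U).fac ((P.proj U).mapCone s) j
  uniq s m hm := hom_ext fun U => (hc U).uniq ((P.proj U).mapCone s) _ fun j =>
    ((P.proj U).map_comp _ _).symm.trans (congrArg _ (hm j))

section

variable (F : J ⥤ P.Des) [∀ U, HasColimitsOfShape J (P.obj U)]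
  [∀ {V U : X} (u : V ⟶ U), PreservesColimitsOfShape J (P.map u)]

/-- The isomorphisms `u^* colim B_U ≅ colim B_V`. -/
noncomputable def colimitIso {V U : X} (u : V ⟶ U) :
    (P.map u).obj (colimit (F ⋙ P.proj U)) ≅ colimit (F ⋙ P.proj V) :=
  preservesColimitIso (P.map u) (F ⋙ P.proj U) ≪≫
    HasColimit.isoOfNatIso (Functor.isoWhiskerLeft F (P.projComp u))

theorem map_ι_colimitIso_hom {V U : X} (u : V ⟶ U) (j : J) :
    (P.map u).map (colimit.ι (F ⋙ P.proj U) j) ≫ (colimitIso F u).hom =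
      (P.projComp u).hom.app (F.obj j) ≫ colimit.ι (F ⋙ P.proj V) j := by
  simp only [colimitIso, Iso.trans_hom]
  rw [ι_preservesColimitIso_hom_assoc]
  exact HasColimit.isoOfNatIso_ι_hom _ _

/-- The colimit of descent data, computed componentwise. -/
noncomputable def colimitObj : P.Des :=
  mk (fun U => colimit (F ⋙ P.proj U)) (colimitIso F) fun {W V U} v u x h => by
    refine (isColimitOfPreserves (P.map u ⋙ P.map v)
      (colimit.isColimit (F ⋙ P.proj U))).hom_ext fun j => ?_
    have h₁ := map_ι_colimitIso_hom F u j
    have h₂ := (P.mapComp v u x h).hom.naturality (colimit.ι (F ⋙ P.proj U) j)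
    simp only [Functor.mapCocone_ι_app, Functor.comp_map, colimit.cocone_ι] at h₂ ⊢
    rw [← Functor.map_comp_assoc, h₁, Functor.map_comp, Category.assoc,
      map_ι_colimitIso_hom, ← Category.assoc, projComp_comp _ v u x h, reassoc_of% h₂,
      map_ι_colimitIso_hom, Category.assoc]

/-- The colimit cocone of descent data. -/
noncomputable def colimitCocone : Cocone F where
  pt := colimitObj F
  ι :=
    { app := fun j => homMk (fun U => colimit.ι (F ⋙ P.proj U) j)
        fun u => map_ι_colimitIso_hom F u j
      naturality := fun _ _ f => hom_ext fun U =>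
        (colimit.w (F ⋙ P.proj U) f).trans (Category.comp_id _).symm }

/-- The projections of the colimit cocone are colimits. -/
noncomputable def isColimitProjColimitCocone (U : X) :
    IsColimit ((P.proj U).mapCocone (colimitCocone F)) :=
  colimit.isColimit (F ⋙ P.proj U)

instance : HasColimitsOfShape J P.Des where
  has_colimit F := ⟨⟨_, isColimitOfProj _ (isColimitProjColimitCocone F)⟩⟩

instance (U : X) : PreservesColimitsOfShape J (P.proj U) where
  preservesColimit {F} := preservesColimit_of_preserves_colimit_cocone
    (isColimitOfProj _ (isColimitProjColimitCocone F)) (isColimitProjColimitCocone F U)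

end

section

variable (F : J ⥤ P.Des) [∀ U, HasLimitsOfShape J (P.obj U)]
  [∀ {V U : X} (u : V ⟶ U), PreservesLimitsOfShape J (P.map u)]

/-- The isomorphisms `u^* lim B_U ≅ lim B_V`. -/
noncomputable def limitIso {V U : X} (u : V ⟶ U) :
    (P.map u).obj (limit (F ⋙ P.proj U)) ≅ limit (F ⋙ P.proj V) :=
  preservesLimitIso (P.map u) (F ⋙ P.proj U) ≪≫
    HasLimit.isoOfNatIso (Functor.isoWhiskerLeft F (P.projComp u))

theorem limitIso_hom_π {V U : X} (u : V ⟶ U) (j : J) :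
    (limitIso F u).hom ≫ limit.π (F ⋙ P.proj V) j =
      (P.map u).map (limit.π (F ⋙ P.proj U) j) ≫ (P.projComp u).hom.app (F.obj j) := by
  simp only [limitIso, Iso.trans_hom, Category.assoc]
  have := HasLimit.isoOfNatIso_hom_π (Functor.isoWhiskerLeft F (P.projComp u)) j
  refine (congrArg _ this).trans ?_
  rw [← Category.assoc]
  exact congrArg (· ≫ _) (preservesLimitIso_hom_π (P.map u) (F ⋙ P.proj U) j)

/-- The limit of descent data, computed componentwise. -/
noncomputable def limitObj : P.Des :=
  mk (fun U => limit (F ⋙ P.proj U)) (limitIso F) fun {W V U} v u x h => by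
    refine limit.hom_ext fun j => ?_
    have h₂ := (P.mapComp v u x h).hom.naturality (limit.π (F ⋙ P.proj U) j)
    simp only [Functor.comp_map] at h₂
    rw [Category.assoc, Category.assoc, limitIso_hom_π, limitIso_hom_π, ← reassoc_of% h₂,
      ← Functor.map_comp_assoc, limitIso_hom_π, Functor.map_comp, Category.assoc]
    exact congrArg _ (projComp_comp _ v u x h)

/-- The limit cone of descent data. -/
noncomputable def limitCone : Cone F where
  pt := limitObj F
  π :=
    { app := fun j => homMk (fun U => limit.π (F ⋙ P.proj U) j)
        fun u => (limitIso_hom_π F u j).symm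
      naturality := fun _ _ f => hom_ext fun U =>
        (Category.id_comp _).trans (limit.w (F ⋙ P.proj U) f).symm }

/-- The projections of the limit cone are limits. -/
noncomputable def isLimitProjLimitCone (U : X) :
    IsLimit ((P.proj U).mapCone (limitCone F)) :=
  limit.isLimit (F ⋙ P.proj U)

instance : HasLimitsOfShape J P.Des where
  has_limit F := ⟨⟨_, isLimitOfProj _ (isLimitProjLimitCone F)⟩⟩

instance (U : X) : PreservesLimitsOfShape J (P.proj U) where
  preservesLimit {F} := preservesLimit_of_preserves_limit_cone
    (isLimitOfProj _ (isLimitProjLimitCone F)) (isLimitProjLimitCone F U)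

end

end Limits

end Des

end KPrestack

theorem abelian_of_toPreadditive_eq {C : Type u} [Category.{v} C] (p : Preadditive C)
    (h : Abelian C) (hp : h.toPreadditive = p) [IsGrothendieckAbelian.{v} C] :
    ∃ (_ : IsNormalMonoCategory C) (_ : IsNormalEpiCategory C) (_ : HasFiniteProducts C)
      (_ : HasKernels C) (_ : HasCokernels C),
      @IsGrothendieckAbelian.{v} C _ (Abelian.mk (toPreadditive := p)) := by
  subst hp
  exact ⟨inferInstance, inferInstance, inferInstance, inferInstance, inferInstance, inferInstance⟩

namespace KLinCat

variable {k : Type w} [CommRing k]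

/-- `KLinCat.IsGrothendieck` as a class. -/
class Grothendieck (C : KLinCat.{v, u} k) : Prop where
  out : C.IsGrothendieck

namespace Grothendieck

variable (C : KLinCat.{v, u} k) [hC : C.Grothendieck]

theorem exists_abelian : ∃ (_ : IsNormalMonoCategory C) (_ : IsNormalEpiCategory C)
      (_ : HasFiniteProducts C) (_ : HasKernels C) (_ : HasCokernels C),
      @IsGrothendieckAbelian.{v} C _ (Abelian.mk (toPreadditive := C.preadditive)) := by
  obtain ⟨h, hp, hG⟩ := hC.out
  exact abelian_of_toPreadditive_eq _ h hp

/-- The abelian structure of a Grothendieck category, on its given additive structure. -/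
instance abelian : Abelian C :=
  have h := exists_abelian C
  { toPreadditive := C.preadditive
    toIsNormalMonoCategory := h.1
    toIsNormalEpiCategory := h.2.1
    has_finite_products := h.2.2.1
    has_kernels := h.2.2.2.1
    has_cokernels := h.2.2.2.2.1 }

instance isGrothendieckAbelian : IsGrothendieckAbelian.{v} C :=
  (exists_abelian C).2.2.2.2.2

end Grothendieck

end KLinCat

namespace KPrestack

namespace Des

variable {k : Type w} [CommRing k] {X : Type v} [Category.{w₂} X] {P : KPrestack.{v, u} k X}
  [∀ U, (P.obj U).Grothendieck]

section

variable [∀ {V U : X} (u : V ⟶ U), PreservesFiniteLimits (P.map u)]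

instance : HasFiniteLimits P.Des := ⟨fun _ _ _ => inferInstance⟩

instance (U : X) : PreservesFiniteLimits (P.proj U) := ⟨fun _ _ _ => inferInstance⟩

theorem mono_iff {B B' : P.Des} (f : B ⟶ B') : Mono f ↔ ∀ U, Mono ((P.proj U).map f) :=
  ⟨fun _ _ => inferInstance, fun _ => ⟨fun _ _ h => hom_ext fun U => by
    rw [← cancel_mono ((P.proj U).map f), ← Functor.map_comp, h, Functor.map_comp]⟩⟩

end

variable [∀ {V U : X} (u : V ⟶ U), PreservesColimitsOfSize.{v, v} (P.map u)]

instance {V U : X} (u : V ⟶ U) : PreservesFiniteColimits (P.map u) :=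
  PreservesColimitsOfSize.preservesFiniteColimits.{v, v} _

instance : HasColimitsOfSize.{v, v} P.Des := ⟨fun _ _ => inferInstance⟩

instance (U : X) : PreservesFiniteColimits (P.proj U) := ⟨fun _ _ _ => inferInstance⟩

theorem epi_iff {B B' : P.Des} (f : B ⟶ B') : Epi f ↔ ∀ U, Epi ((P.proj U).map f) :=
  ⟨fun _ _ => inferInstance, fun _ => ⟨fun _ _ h => hom_ext fun U => by
    rw [← cancel_epi ((P.proj U).map f), ← Functor.map_comp, h, Functor.map_comp]⟩⟩

variable [∀ {V U : X} (u : V ⟶ U), PreservesFiniteLimits (P.map u)]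

instance : HasFiniteProducts P.Des := inferInstance

instance : HasKernels P.Des := inferInstance

instance : HasCokernels P.Des := inferInstance

instance : IsNormalMonoCategory P.Des where
  normalMonoOfMono f hf := ⟨
    { Z := cokernel f
      g := cokernel.π f
      w := cokernel.condition f
      isLimit := isLimitOfProj _ fun U =>
        have := (mono_iff f).1 hf U
        (KernelFork.isLimitMapConeEquiv _ _).symm
          (Abelian.monoIsKernelOfCokernel _
            (CokernelCofork.mapIsColimit _ (cokernelIsCokernel f) (P.proj U))) }⟩

instance : IsNormalEpiCategory P.Des where
  normalEpiOfEpi f hf := ⟨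
    { W := kernel f
      g := kernel.ι f
      w := kernel.condition f
      isColimit := isColimitOfProj _ fun U =>
        have := (epi_iff f).1 hf U
        (CokernelCofork.isColimitMapCoconeEquiv _ _).symm
          (Abelian.epiIsCokernelOfKernel _
            (KernelFork.mapIsLimit _ (kernelIsKernel f) (P.proj U))) }⟩

instance : Abelian P.Des where

instance (J : Type v) [SmallCategory J] [IsFiltered J] : HasExactColimitsOfShape J P.Des where
  preservesFiniteLimits := ⟨fun I _ _ => ⟨fun {G} => ⟨fun {c} hc => ⟨by
    refine isLimitOfProj _ fun U => ?_
    have : PreservesLimitsOfShape I (colim (J := J) ⋙ P.proj U) :=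
      preservesLimitsOfShape_of_natIso (preservesColimitNatIso (P.proj U)).symm
    exact isLimitOfPreserves (colim ⋙ P.proj U) hc⟩⟩⟩⟩

instance : AB5OfSize.{v, v} P.Des where
  ofShape _ _ _ := inferInstance

end Des

end KPrestack

/-- The closure of a point under a set-valued map with small values is small. -/
theorem exists_small_closed {α : Type u} {κ : Cardinal.{v}} [Fact κ.IsRegular]
    (hκ : HasCardinalLT ℕ κ) (T : α → Set α) (hT : ∀ x, HasCardinalLT (T x) κ) (x₀ : α) :
    ∃ S : Set α, x₀ ∈ S ∧ HasCardinalLT S κ ∧ ∀ x ∈ S, T x ⊆ S := by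
  let S (n : ℕ) : Set α := (fun A : Set α => ⋃ x : A, T x)^[n] {x₀}
  have hS : ∀ n, HasCardinalLT (↥(S n)) κ := fun n => by
    induction n with
    | zero => exact hasCardinalLT_of_finite ({x₀} : Set α) κ (Fact.out : κ.IsRegular).aleph0_le
    | succ n ih =>
      simp only [S, Function.iterate_succ_apply']
      exact hasCardinalLT_iUnion _ ih fun x => hT x
  refine ⟨⋃ n, S n, Set.mem_iUnion.2 ⟨0, rfl⟩, hasCardinalLT_iUnion _ hκ hS, fun x hx y hy => ?_⟩
  obtain ⟨n, hn⟩ := Set.mem_iUnion.1 hx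
  refine Set.mem_iUnion.2 ⟨n + 1, ?_⟩
  simp only [S, Function.iterate_succ_apply']
  exact Set.mem_iUnion.2 ⟨⟨x, hn⟩, hy⟩

namespace CategoryTheory.IsGrothendieckAbelian

variable {C : Type u} [Category.{v} C] [Abelian C] [IsGrothendieckAbelian.{v} C]
  {G M : C}

/-- The map `⨁_{j ∈ J} G ⟶ M` given by a set `J` of morphisms `G ⟶ M`. -/
noncomputable def fromSpan (J : Set (G ⟶ M)) : (∐ fun _ : J => G) ⟶ M :=
  Limits.Sigma.desc fun j => j.1

/-- The subobject of `M` generated by a set of morphisms `G ⟶ M`. -/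
noncomputable def span (J : Set (G ⟶ M)) : C := image (fromSpan J)

/-- The inclusion of `span J`. -/
noncomputable def spanι (J : Set (G ⟶ M)) : span J ⟶ M := image.ι _

instance (J : Set (G ⟶ M)) : Mono (spanι J) := inferInstanceAs (Mono (image.ι _))

/-- The projection onto `span J`. -/
noncomputable def spanπ (J : Set (G ⟶ M)) : (∐ fun _ : J => G) ⟶ span J :=
  factorThruImage _

instance (J : Set (G ⟶ M)) : Epi (spanπ J) := inferInstanceAs (Epi (factorThruImage _))

/-- The generators of `span J`. -/
noncomputable def spanGen (J : Set (G ⟶ M)) (j : J) : G ⟶ span J :=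
  Sigma.ι (fun _ : J => G) j ≫ spanπ J

@[simp]
theorem spanGen_ι (J : Set (G ⟶ M)) (j : J) : spanGen J j ≫ spanι J = j.1 := by
  rw [spanGen, Category.assoc, spanπ, spanι]
  erw [image.fac]
  exact Limits.Sigma.ι_desc _ _

theorem span_hom_ext {J : Set (G ⟶ M)} {N : C} {f g : span J ⟶ N}
    (h : ∀ j, spanGen J j ≫ f = spanGen J j ≫ g) : f = g := by
  rw [← cancel_epi (spanπ J)]
  refine Sigma.hom_ext _ _ fun j => ?_
  simpa [spanGen] using h j

section

variable {D : Type u'} [Category.{v} D] [Abelian D] (F : C ⥤ D)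
  [PreservesColimitsOfSize.{v, v} F]

/-- A subobject of `F M` which contains the images of the elements of `J` contains the image
of `span J`. -/
theorem exists_map_span_lift (J : Set (G ⟶ M)) {N S : D} (i : F.obj M ⟶ N) (m : S ⟶ N) [Mono m]
    (h : ∀ j : J, ∃ l, l ≫ m = F.map j.1 ≫ i) : ∃ l, l ≫ m = F.map (spanι J) ≫ i := by
  have : PreservesFiniteColimits F := PreservesColimitsOfSize.preservesFiniteColimits.{v, v} F
  choose l hl using h
  let c := isColimitCofanMkObjOfIsColimit F _ _ (coproductIsCoproduct fun _ : J => G)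
  have sq : CommSq (Cofan.IsColimit.desc c l) (F.map (spanπ J)) m (F.map (spanι J) ≫ i) := ⟨by
    refine Cofan.IsColimit.hom_ext c _ _ fun j => ?_
    rw [Cofan.IsColimit.fac_assoc, hl, ← spanGen_ι J j, spanGen]
    simp⟩
  have : Epi (F.map (spanπ J)) := F.map_epi _
  have : StrongEpi (F.map (spanπ J)) := strongEpi_of_epi _
  exact ⟨sq.lift, sq.fac_right⟩

end

theorem exists_span_lift (J : Set (G ⟶ M)) {S : C} (m : S ⟶ M) [Mono m]
    (h : ∀ j : J, ∃ l, l ≫ m = j.1) : ∃ l, l ≫ m = spanι J := by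
  simpa using exists_map_span_lift (𝟭 C) J (𝟙 M) m (by simpa using h)

/-- The maps between subobjects generated by sets of morphisms. -/
noncomputable def spanMap {J J' : Set (G ⟶ M)} (h : J ⊆ J') : span J ⟶ span J' :=
  (exists_span_lift J (spanι J') fun j => ⟨_, spanGen_ι J' ⟨j.1, h j.2⟩⟩).choose

@[simp]
theorem spanMap_ι {J J' : Set (G ⟶ M)} (h : J ⊆ J') : spanMap h ≫ spanι J' = spanι J :=
  (exists_span_lift J (spanι J') fun j => ⟨_, spanGen_ι J' ⟨j.1, h j.2⟩⟩).choose_spec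

/-- The diagram of the subobjects generated by less than `κ` morphisms. -/
noncomputable def spanFunctor (G M : C) (κ : Cardinal.{v}) :
    {J : Set (G ⟶ M) // HasCardinalLT J κ} ⥤ MonoOver M where
  obj J := MonoOver.mk (spanι J.1)
  map h := MonoOver.homMk (spanMap (leOfHom h)) (spanMap_ι _)

theorem isCardinalFiltered_small_sets {α : Type v} (κ : Cardinal.{v}) [Fact κ.IsRegular] :
    IsCardinalFiltered {J : Set α // HasCardinalLT J κ} κ :=
  isCardinalFiltered_preorder _ _ fun _ s hK =>
    ⟨⟨⋃ i, (s i).1, hasCardinalLT_iUnion _ ((hasCardinalLT_iff_cardinal_mk_lt _ _).2 hK)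
      fun i => (s i).2⟩, fun i => Set.subset_iUnion (fun i => (s i).1) i⟩

/-- The colimit cocone of the subobjects generated by less than `κ` morphisms. -/
noncomputable def spanCocone (G M : C) (κ : Cardinal.{v}) :
    Cocone (spanFunctor G M κ ⋙ MonoOver.forget M) where
  pt := Over.mk (𝟙 M)
  ι :=
    { app := fun J => Over.homMk (spanι J.1) (Category.comp_id _)
      naturality := fun _ _ h => Over.OverMorphism.ext
        ((spanMap_ι (leOfHom h)).trans (Category.comp_id _).symm) }

theorem nonempty_isColimit_spanCocone (hG : IsSeparator G) (M : C) (κ : Cardinal.{v})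
    [Fact κ.IsRegular] :
    Nonempty (IsColimit ((Over.forget M).mapCocone (spanCocone G M κ))) := by
  have := isCardinalFiltered_small_sets (α := G ⟶ M) κ
  have := isFiltered_of_isCardinalFiltered {J : Set (G ⟶ M) // HasCardinalLT J κ} κ
  have : Mono (spanCocone G M κ).pt.hom := inferInstanceAs (Mono (𝟙 M))
  refine ⟨isColimitMapCoconeOfSubobjectMkEqISup _ _ ?_⟩
  let S := ⨆ J, Subobject.mk ((spanFunctor G M κ).obj J).obj.hom
  change Subobject.mk (𝟙 M) = S
  have : IsIso S.arrow := hG.isDetector.def _ fun h => by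
    have hJ : HasCardinalLT ({h} : Set (G ⟶ M)) κ :=
      hasCardinalLT_of_finite _ κ (Fact.out : κ.IsRegular).aleph0_le
    have hS : S.Factors h := Subobject.factors_of_le h
      (le_iSup (fun J => Subobject.mk ((spanFunctor G M κ).obj J).obj.hom) ⟨{h}, hJ⟩)
      ((Subobject.mk_factors_iff _ _).2 ⟨spanGen {h} ⟨h, rfl⟩, spanGen_ι _ _⟩)
    exact ⟨S.factorThru h hS, Subobject.factorThru_arrow _ _ _, fun l hl => by
      rw [← cancel_mono S.arrow, hl, Subobject.factorThru_arrow]⟩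
  rw [← Subobject.top_eq_id]
  exact (Subobject.eq_top_of_isIso_arrow S).symm

theorem exists_small_span_lift (hG : IsSeparator G) {κ : Cardinal.{v}} [Fact κ.IsRegular]
    {D : Type u'} [Category.{v} D] [Abelian D] [IsGrothendieckAbelian.{v} D] (F : C ⥤ D)
    [PreservesColimitsOfSize.{v, v} F] [PreservesFiniteLimits F] {H : D}
    (hH : HasCardinalLT (Subobject H) κ) (h : H ⟶ F.obj M) :
    ∃ J : Set (G ⟶ M), HasCardinalLT J κ ∧ ∃ l, l ≫ F.map (spanι J) = h := by
  have := isCardinalFiltered_small_sets (α := G ⟶ M) κ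
  obtain ⟨hc⟩ := nonempty_isColimit_spanCocone hG M κ
  let Y := ((spanFunctor G M κ ⋙ MonoOver.forget M) ⋙ Over.forget M) ⋙ F
  have : ∀ (j j') (φ : j ⟶ j'), Mono (Y.map φ) := fun j j' φ => by
    have : Mono (spanMap (leOfHom φ)) := mono_of_mono_fac (spanMap_ι (leOfHom φ))
    exact inferInstanceAs (Mono (F.map (spanMap (leOfHom φ))))
  have : PreservesColimit (((spanFunctor G M κ ⋙ MonoOver.forget M) ⋙ Over.forget M) ⋙ F)
      (coyoneda.obj (Opposite.op H)) := preservesColimit_coyoneda_obj_of_mono Y hH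
  have hc' := isColimitOfPreserves (coyoneda.obj (Opposite.op H)) (isColimitOfPreserves F hc)
  obtain ⟨J, l, hl⟩ := Types.jointly_surjective_of_isColimit hc' h
  exact ⟨J.1, J.2, l, hl⟩

end CategoryTheory.IsGrothendieckAbelian

namespace KPrestack

namespace Des

open CategoryTheory.IsGrothendieckAbelian

variable {k : Type w} [CommRing k] {X : Type v} [SmallCategory X] {P : KPrestack.{v, u} k X}
  [∀ U, (P.obj U).Grothendieck] [∀ {V U : X} (u : V ⟶ U), PreservesFiniteLimits (P.map u)]
  [∀ {V U : X} (u : V ⟶ U), PreservesColimitsOfSize.{v, v} (P.map u)]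

section Span

variable (D : P.Des) (G : ∀ U, P.obj U)
  (J : ∀ U, Set (G U ⟶ (P.proj U).obj D))

theorem exists_spanIso
    (h₁ : ∀ {V U : X} (u : V ⟶ U) (j : J U) (g : G V ⟶ (P.map u).obj (G U)),
      g ≫ (P.map u).map j.1 ≫ (P.projComp u).hom.app D ∈ J V)
    (h₂ : ∀ {V U : X} (u : V ⟶ U) (j : J V),
      ∃ l, l ≫ (P.map u).map (spanι (J U)) = j.1 ≫ (P.projComp u).inv.app D)
    (hG : ∀ U, IsSeparator (G U)) {V U : X} (u : V ⟶ U) :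
    ∃ e : (P.map u).obj (span (J U)) ≅ span (J V),
      e.hom ≫ spanι (J V) = (P.map u).map (spanι (J U)) ≫ (P.projComp u).hom.app D := by
  obtain ⟨l, hl⟩ := exists_map_span_lift (P.map u) (J U) ((P.projComp u).hom.app D)
    (spanι (J V)) fun j => by
      obtain ⟨l, hl⟩ := exists_map_span_lift (𝟭 (P.obj V)) (M := (P.map u).obj (G U))
        (G := G V) Set.univ ((P.map u).map j.1 ≫ (P.projComp u).hom.app D) (spanι (J V))
        fun g => ⟨_, spanGen_ι (J V) ⟨_, h₁ u j g.1⟩⟩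
      have : IsIso (spanι (Set.univ : Set (G V ⟶ (P.map u).obj (G U)))) :=
        (hG V).isDetector.def _ fun h => ⟨spanGen _ ⟨h, trivial⟩, spanGen_ι _ _, fun l hl => by
          rw [← cancel_mono (spanι _), hl, spanGen_ι]⟩
      exact ⟨inv (spanι Set.univ) ≫ l, by rw [Category.assoc, hl]; simp⟩
  obtain ⟨m, hm⟩ := exists_span_lift (J V)
    ((P.map u).map (spanι (J U)) ≫ (P.projComp u).hom.app D) fun j => by
      obtain ⟨l, hl⟩ := h₂ u j
      exact ⟨l, by rw [reassoc_of% hl]; simp⟩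
  refine ⟨⟨l, m, ?_, ?_⟩, hl⟩
  · rw [← cancel_mono ((P.map u).map (spanι (J U)) ≫ (P.projComp u).hom.app D), Category.assoc,
      hm, hl, Category.id_comp]
  · rw [← cancel_mono (spanι (J V)), Category.assoc, hl, hm, Category.id_comp]

/-- Sets of morphisms which are closed under restriction, and locally generated, generate a
subobject of a descent datum. -/
theorem exists_span
    (h₁ : ∀ {V U : X} (u : V ⟶ U) (j : J U) (g : G V ⟶ (P.map u).obj (G U)),
      g ≫ (P.map u).map j.1 ≫ (P.projComp u).hom.app D ∈ J V)
    (h₂ : ∀ {V U : X} (u : V ⟶ U) (j : J V),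
      ∃ l, l ≫ (P.map u).map (spanι (J U)) = j.1 ≫ (P.projComp u).inv.app D)
    (hG : ∀ U, IsSeparator (G U)) :
    ∃ (D' : P.Des) (i : D' ⟶ D) (e : ∀ U, (P.proj U).obj D' ≅ span (J U)),
      ∀ U, (P.proj U).map i = (e U).hom ≫ spanι (J U) := by
  choose e he using fun {V U : X} (u : V ⟶ U) => exists_spanIso D G J h₁ h₂ hG u
  refine ⟨mk (fun U => span (J U)) (fun u => e u) fun {W V U} v u x h => ?_,
    homMk (fun U => spanι (J U)) fun u => (he u).symm, fun U => Iso.refl _,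
    fun U => (Category.id_comp _).symm⟩
  have := (P.mapComp v u x h).hom.naturality (spanι (J U))
  simp only [Functor.comp_map] at this
  rw [← cancel_mono (spanι (J W)), Category.assoc, Category.assoc, he, he, ← reassoc_of% this,
    ← Functor.map_comp_assoc, he, Functor.map_comp, Category.assoc, projComp_comp D v u x h]

end Span

theorem exists_small_sub (D : P.Des) (G : ∀ U, P.obj U) (hG : ∀ U, IsSeparator (G U))
    {κ : Cardinal.{v}} [Fact κ.IsRegular] (hκ : HasCardinalLT ℕ κ)
    (hX : HasCardinalLT (Arrow X) κ) (hS : ∀ U, HasCardinalLT (Subobject (G U)) κ)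
    (hH : ∀ {V U : X} (u : V ⟶ U), HasCardinalLT (G V ⟶ (P.map u).obj (G U)) κ)
    {U₀ : X} (j₀ : G U₀ ⟶ (P.proj U₀).obj D) :
    ∃ (D' : P.Des) (i : D' ⟶ D), (∃ l, l ≫ (P.proj U₀).map i = j₀) ∧
      ∀ U, ∃ p : (∐ fun _ : κ.out => G U) ⟶ (P.proj U).obj D', Epi p := by
  choose c hc l hl using fun {V U : X} (u : V ⟶ U) (j : G V ⟶ (P.proj V).obj D) =>
    exists_small_span_lift (hG U) (P.map u) (hS V) (j ≫ (P.projComp u).inv.app D)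
  let T : (Σ U, (G U ⟶ (P.proj U).obj D)) → Set (Σ U, (G U ⟶ (P.proj U).obj D)) := fun x =>
    (⋃ a : Σ V, (V ⟶ x.1), Set.range fun g : G a.1 ⟶ (P.map a.2).obj (G x.1) =>
      ⟨a.1, g ≫ (P.map a.2).map x.2 ≫ (P.projComp a.2).hom.app D⟩) ∪
    (⋃ a : Σ W, (x.1 ⟶ W), Sigma.mk a.1 '' c a.2 x.2)
  have hT : ∀ x, HasCardinalLT (↥(T x)) κ := fun x => by
    have hX₁ : HasCardinalLT (Σ V, (V ⟶ x.1)) κ :=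
      hX.of_injective (fun a => Arrow.mk a.2) fun ⟨V, a⟩ ⟨V', a'⟩ h => by
        cases h
        rfl
    have hX₂ : HasCardinalLT (Σ W, (x.1 ⟶ W)) κ :=
      hX.of_injective (fun a => Arrow.mk a.2) fun ⟨V, a⟩ ⟨V', a'⟩ h => by
        cases h
        rfl
    exact hasCardinalLT_union (Fact.out : κ.IsRegular).aleph0_le
      (hasCardinalLT_iUnion _ hX₁ fun a => (hH a.2).of_surjective _ Set.rangeFactorization_surjective)
      (hasCardinalLT_iUnion _ hX₂ fun a => (hc a.2 x.2).of_surjective _ Set.imageFactorization_surjective)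
  obtain ⟨S, hS₀, hSκ, hST⟩ := exists_small_closed hκ T hT ⟨U₀, j₀⟩
  let J : ∀ U, Set (G U ⟶ (P.proj U).obj D) := fun U => {j | ⟨U, j⟩ ∈ S}
  have hJ : ∀ U, HasCardinalLT (J U) κ := fun U => 
    hSκ.of_injective (fun j => (⟨⟨U, j.1⟩, j.2⟩ : S)) fun j j' h => by
      simpa [Subtype.ext_iff] using h
  obtain ⟨D', i, e, he⟩ := exists_span D G J
    (fun {V U} u j g => hST _ j.2 (Or.inl (Set.mem_iUnion.2 ⟨⟨V, u⟩, g, rfl⟩)))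
    (fun {V U} u j => by
      have : c u j.1 ⊆ J U := fun j' hj' =>
        hST _ j.2 (Or.inr (Set.mem_iUnion.2 ⟨⟨U, u⟩, j', hj', rfl⟩))
      exact ⟨l u j.1 ≫ (P.map u).map (spanMap this), by
        rw [Category.assoc, ← Functor.map_comp, spanMap_ι, hl]⟩) hG
  refine ⟨D', i, ⟨spanGen (J U₀) ⟨j₀, hS₀⟩ ≫ (e U₀).inv, by simp [he]⟩, fun U => ?_⟩
  have hJ' := hJ U
  rw [hasCardinalLT_iff_cardinal_mk_lt, ← Cardinal.mk_out κ] at hJ'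
  obtain ⟨f⟩ := hJ'.le
  classical
  refine ⟨Limits.Sigma.desc (fun a => if h : ∃ j, f j = a then spanGen (J U) h.choose else 0) ≫
    (e U).inv, ?_⟩
  have : Epi (Limits.Sigma.desc fun a : κ.out =>
      if h : ∃ j, f j = a then spanGen (J U) h.choose else 0) := ⟨fun g g' h => by
    refine span_hom_ext fun j => ?_
    have hj : ∃ j', f j' = f j := ⟨j, rfl⟩
    have := congrArg (Limits.Sigma.ι (fun _ : κ.out => G U) (f j) ≫ ·) h
    simpa only [Limits.Sigma.ι_desc_assoc, dif_pos hj, f.injective hj.choose_spec] using this⟩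
  infer_instance

end Des

end KPrestack

namespace KPrestack

namespace Des

open CategoryTheory.IsGrothendieckAbelian

variable {k : Type w} [CommRing k] {X : Type v} [SmallCategory X] {P : KPrestack.{v, u} k X}
  [∀ U, (P.obj U).Grothendieck]

variable (P) in
/-- Families of quotients of given objects, with gluing morphisms. -/
abbrev QuotientData (H : ∀ U, P.obj U) :=
  Σ K : ∀ U, Subobject (H U), ∀ a : Arrow X,
    (P.map a.hom).obj (cokernel (K a.right).arrow) ⟶ cokernel (K a.left).arrow

/-- A descent datum is presented by `c` if it is isomorphic to the quotients given by `c`. -/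
def IsPresentedBy {H : ∀ U, P.obj U} (c : QuotientData P H) (D : P.Des) : Prop :=
  ∃ e : ∀ U, (P.proj U).obj D ≅ cokernel (c.1 U).arrow, ∀ {V U : X} (u : V ⟶ U),
    (P.map u).map (e U).hom ≫ c.2 (Arrow.mk u) = (P.projComp u).hom.app D ≫ (e V).hom

theorem IsPresentedBy.nonempty_iso {H : ∀ U, P.obj U} {c : QuotientData P H} {D D' : P.Des}
    (h : IsPresentedBy c D) (h' : IsPresentedBy c D') : Nonempty (D ≅ D') := by
  obtain ⟨e, he⟩ := h
  obtain ⟨e', he'⟩ := h'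
  refine ⟨isoMk (fun U => e U ≪≫ (e' U).symm) fun {V U} u => ?_⟩
  rw [← cancel_mono (e' V).hom, Category.assoc, ← he' u, ← Functor.map_comp_assoc]
  simp [he u]

theorem exists_isPresentedBy {H : ∀ U, P.obj U} {D : P.Des} (p : ∀ U, H U ⟶ (P.proj U).obj D)
    [∀ U, Epi (p U)] : ∃ c : QuotientData P H, IsPresentedBy c D := by
  let K U := kernelSubobject (p U)
  have hp U : (K U).arrow ≫ p U = 0 := kernelSubobject_arrow_comp _
  have e U : (P.proj U).obj D ≅ cokernel (K U).arrow := by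
    refine IsColimit.coconePointUniqueUpToIso
      (Abelian.epiIsCokernelOfKernel (KernelFork.ofι (K U).arrow (hp U)) ?_)
      (colimit.isColimit _)
    exact (kernelIsKernel (p U)).ofIsoLimit (Fork.ext (kernelSubobjectIso _).symm
      (kernelSubobject_arrow' _))
  exact ⟨⟨K, fun a => (P.map a.hom).map (e a.right).inv ≫ (P.projComp a.hom).hom.app D ≫
    (e a.left).hom⟩, e, fun {V U} u => by
    dsimp only [Arrow.mk_hom]
    rw [← Functor.map_comp_assoc]
    simp⟩

/-- The descent data with components that are quotients of given objects form a set, up to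
isomorphism. -/
theorem exists_small_family (H : ∀ U, P.obj U) :
    ∃ (I : Type v) (D : I → P.Des), ∀ (D' : P.Des) (p : ∀ U, H U ⟶ (P.proj U).obj D')
      [∀ U, Epi (p U)], ∃ i, Nonempty (D i ≅ D') := by
  let e := equivShrink.{v} {c : QuotientData P H // ∃ D, IsPresentedBy c D}
  have he i := (e.symm i).2
  choose D hD using he
  refine ⟨_, D, fun D' p _ => ?_⟩
  obtain ⟨c, hc⟩ := exists_isPresentedBy p
  have hc' := hD (e ⟨c, D', hc⟩)
  rw [Equiv.symm_apply_apply] at hc'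
  exact ⟨_, hc'.nonempty_iso hc⟩

theorem exists_cardinal (G : ∀ U, P.obj U) : ∃ κ : Cardinal.{v}, κ.IsRegular ∧
    HasCardinalLT ℕ κ ∧ HasCardinalLT (Arrow X) κ ∧ (∀ U, HasCardinalLT (Subobject (G U)) κ) ∧
      ∀ {V U : X} (u : V ⟶ U), HasCardinalLT (G V ⟶ (P.map u).obj (G U)) κ := by
  obtain ⟨κ, hκ, h⟩ := HasCardinalLT.exists_regular_cardinal.{v}
    ((ℕ ⊕ Arrow X) ⊕ ((Σ U, Subobject (G U)) ⊕
      (Σ a : Arrow X, (G a.left ⟶ (P.map a.hom).obj (G a.right)))))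
  simp only [hasCardinalLT_sum_iff _ _ _ hκ.aleph0_le] at h
  obtain ⟨⟨h₁, h₂⟩, h₃, h₄⟩ := h
  exact ⟨κ, hκ, h₁, h₂, fun U => h₃.of_injective (fun S => ⟨U, S⟩) fun _ _ h => by simpa using h,
    fun {V U} u => h₄.of_injective (fun g => ⟨Arrow.mk u, g⟩) fun _ _ h => by simpa using h⟩

variable [∀ {V U : X} (u : V ⟶ U), PreservesFiniteLimits (P.map u)]
  [∀ {V U : X} (u : V ⟶ U), PreservesColimitsOfSize.{v, v} (P.map u)]

instance : HasSeparator P.Des := by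
  have hG U : IsSeparator (separator (P.obj U)) := isSeparator_separator _
  obtain ⟨κ, hκ, h₁, h₂, h₃, h₄⟩ := exists_cardinal fun U => separator (P.obj U)
  have : Fact κ.IsRegular := ⟨hκ⟩
  obtain ⟨I, D, hD⟩ := exists_small_family fun U => ∐ fun _ : κ.out => separator (P.obj U)
  refine ⟨∐ D, (isSeparator_sigma D).2 fun B B' f g hfg => hom_ext fun U =>
    (hG U).def _ _ fun j => ?_⟩
  obtain ⟨D', i, ⟨l, hl⟩, hp⟩ := exists_small_sub B _ hG h₁ h₂ h₃ h₄ j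
  choose p hp using hp
  obtain ⟨c, ⟨e⟩⟩ := hD D' p
  have := hfg _ ⟨c⟩ (e.hom ≫ i)
  rw [Category.assoc, Category.assoc, cancel_epi] at this
  rw [← hl, Category.assoc, Category.assoc, ← Functor.map_comp, this, Functor.map_comp]

instance : IsGrothendieckAbelian.{v} P.Des where

theorem isGrothendieck : P.Des.IsGrothendieck :=
  ⟨inferInstance, rfl, inferInstance⟩

end Des

end KPrestack

namespace KPrestack

section

variable {k : Type w} [CommRing k] {X : Type w₁} [Category.{w₂} X] (P : KPrestack.{v, u} k X)

/-- Fully faithful exact right adjoints `v_*` of the restriction functors `v^*`, such that for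
each pullback square, the functor `w^* v_*` takes values in the essential image of `v₁_*`. -/
structure Pushforwards where
  pf {V U : X} (v : V ⟶ U) : P.obj V ⥤ P.obj U
  adj {V U : X} (v : V ⟶ U) : P.map v ⊣ pf v
  full {V U : X} (v : V ⟶ U) : (pf v).Full
  faithful {V U : X} (v : V ⟶ U) : (pf v).Faithful
  exact {V U : X} (v : V ⟶ U) : IsExactFunctor (pf v)
  mem_essImage {Q V W U : X} {w₁ : Q ⟶ V} {v₁ : Q ⟶ W} {v : V ⟶ U} {w : W ⟶ U}
    (h : IsPullback w₁ v₁ v w) (B : P.obj V) :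
    (pf v₁).essImage ((P.map w).obj ((pf v).obj B))

attribute [instance] Pushforwards.full Pushforwards.faithful

variable {P}

/-- If `v_* v^*` followed by `w_* w^*` is `u_* u^*`, then `w^* v_*` takes values in the essential
image of `v₁_*`. -/
theorem mem_essImage_of_iso {Q V W U : X} {v₁ : Q ⟶ W} {v : V ⟶ U} {w : W ⟶ U} {u : Q ⟶ U}
    (h : v₁ ≫ w = u) {Rv : P.obj V ⥤ P.obj U} (av : P.map v ⊣ Rv) [Rv.Full] [Rv.Faithful]
    {Rw : P.obj W ⥤ P.obj U} (aw : P.map w ⊣ Rw) [Rw.Full] [Rw.Faithful]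
    {Ru : P.obj Q ⥤ P.obj U} (au : P.map u ⊣ Ru)
    {Rv₁ : P.obj Q ⥤ P.obj W} (av₁ : P.map v₁ ⊣ Rv₁)
    (e : (P.map v ⋙ Rv) ⋙ (P.map w ⋙ Rw) ≅ P.map u ⋙ Ru) (B : P.obj V) :
    Rv₁.essImage ((P.map w).obj (Rv.obj B)) := by
  let e₁ : Ru ≅ Rv₁ ⋙ Rw := au.rightAdjointUniq
    ((aw.comp av₁).ofNatIsoLeft (P.mapComp v₁ w u h))
  let e₂ : Rw.obj ((P.map w).obj (Rv.obj B)) ≅ Rw.obj (Rv₁.obj ((P.map u).obj (Rv.obj B))) :=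
    (P.map w ⋙ Rw).mapIso (Rv.mapIso (asIso (av.counit.app B)).symm) ≪≫ e.app (Rv.obj B) ≪≫
      e₁.app _
  exact ⟨_, ⟨(Rw.preimageIso e₂).symm⟩⟩

theorem IsAffineLocalization.nonempty_pushforwards (h : P.IsAffineLocalization) :
    Nonempty P.Pushforwards := by
  obtain ⟨R, hR, hR'⟩ := h.rightAdjoint
  have hF {V U : X} (v : V ⟶ U) : (R v).Full := (hR v).2.1
  have hf {V U : X} (v : V ⟶ U) : (R v).Faithful := (hR v).2.2.1
  exact ⟨
    { pf := R
      adj := fun v => (hR v).1.some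
      full := hF
      faithful := hf
      exact := fun v => (hR v).2.2.2
      mem_essImage := fun {Q V W U w₁ v₁ v w} sq B =>
        mem_essImage_of_iso sq.w.symm (hR v).1.some (hR w).1.some (hR (w₁ ≫ v)).1.some
          (hR v₁).1.some (hR' w₁ v₁ v w sq _ rfl).2.some B }⟩

end

variable {k : Type w} [CommRing k] {X : Type v} [SemilatticeInf X] {P : KPrestack.{v, u} k X}

theorem full_faithful_of_le {V U : X} (u : V ⟶ U) (h : U ≤ V) :
    (P.map u).Full ∧ (P.map u).Faithful := by
  obtain rfl := le_antisymm u.le h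
  rw [Subsingleton.elim u (𝟙 V)]
  exact ⟨Functor.Full.of_iso (P.mapId V), Functor.Faithful.of_iso (P.mapId V)⟩

namespace Pushforwards

/-- The inclusion `U ∩ V ⟶ U`. -/
abbrev fst (U V : X) : U ⊓ V ⟶ U := homOfLE inf_le_left

/-- The inclusion `U ∩ V ⟶ V`. -/
abbrev snd (U V : X) : U ⊓ V ⟶ V := homOfLE inf_le_right

/-- The inclusion `U ∩ W ⟶ U ∩ V` for `W ⟶ V`. -/
abbrev infMap (U : X) {W V : X} (x : W ⟶ V) : U ⊓ W ⟶ U ⊓ V := homOfLE (inf_le_inf_left U x.le)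

theorem isPullback_inf (U : X) {W V : X} (x : W ⟶ V) :
    IsPullback (infMap U x) (snd U W) (snd U V) x :=
  ⟨⟨Subsingleton.elim _ _⟩, ⟨PullbackCone.IsLimit.mk _
    (fun s => homOfLE (le_inf (s.fst.le.trans inf_le_left) s.snd.le))
    (fun _ => Subsingleton.elim _ _) (fun _ => Subsingleton.elim _ _)
    (fun _ _ _ _ => Subsingleton.elim _ _)⟩⟩

/-- The inclusion `U ∩ W ⟶ V` for `W ⟶ V`. -/
abbrev diag (U : X) {W V : X} (x : W ⟶ V) : U ⊓ W ⟶ V := homOfLE (inf_le_right.trans x.le)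

variable (R : P.Pushforwards) (U : X)

/-- The object `q_* p^* M` for `p : U ∩ V ⟶ U` and `q : U ∩ V ⟶ V`. -/
abbrev sec (V : X) (M : P.obj U) : P.obj V := (R.pf (snd U V)).obj ((P.map (fst U V)).obj M)

/-- The counit `q^* q_* p^* M ⟶ p^* M`. -/
noncomputable def ev (V : X) (M : P.obj U) :
    (P.map (snd U V)).obj (R.sec U V M) ⟶ (P.map (fst U V)).obj M :=
  (R.adj (snd U V)).counit.app _

instance (V : X) (M : P.obj U) : IsIso (R.ev U V M) := by
  unfold ev
  infer_instance

/-- For `x : W ⟶ V`, the isomorphism `q^* x^* B ≅ (U ∩ W ⟶ U ∩ V)^* q^* B`. -/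
noncomputable def exchange {W V : X} (x : W ⟶ V) (B : P.obj V) :
    (P.map (snd U W)).obj ((P.map x).obj B) ≅
      (P.map (infMap U x)).obj ((P.map (snd U V)).obj B) :=
  (P.mapComp (snd U W) x (diag U x) (Subsingleton.elim _ _)).app B ≪≫
    ((P.mapComp (infMap U x) (snd U V) (diag U x) (Subsingleton.elim _ _)).app B).symm

theorem exchange_naturality {W V : X} (x : W ⟶ V) {B B' : P.obj V} (f : B ⟶ B') :
    (P.map (snd U W)).map ((P.map x).map f) ≫ (exchange U x B').hom =
      (exchange U x B).hom ≫ (P.map (infMap U x)).map ((P.map (snd U V)).map f) := by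
  have h₁ := (P.mapComp (snd U W) x (diag U x) (Subsingleton.elim _ _)).hom.naturality f
  have h₂ := (P.mapComp (infMap U x) (snd U V) (diag U x)
    (Subsingleton.elim _ _)).inv.naturality f
  simp only [Functor.comp_map] at h₁ h₂
  simp only [exchange, Iso.trans_hom, Iso.app_hom, Iso.symm_hom, Iso.app_inv, Category.assoc]
  rw [← h₂, reassoc_of% h₁]

/-- For `x : W ⟶ V`, the isomorphism `(U ∩ W ⟶ U ∩ V)^* p^* M ≅ p^* M`. -/
noncomputable def restr {W V : X} (x : W ⟶ V) (M : P.obj U) :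
    (P.map (infMap U x)).obj ((P.map (fst U V)).obj M) ≅ (P.map (fst U W)).obj M :=
  (P.mapComp (infMap U x) (fst U V) (fst U W) (Subsingleton.elim _ _)).app M

theorem restr_naturality {W V : X} (x : W ⟶ V) {M M' : P.obj U} (f : M ⟶ M') :
    (P.map (infMap U x)).map ((P.map (fst U V)).map f) ≫ (restr U x M').hom =
      (restr U x M).hom ≫ (P.map (fst U W)).map f :=
  (P.mapComp (infMap U x) (fst U V) (fst U W) (Subsingleton.elim _ _)).hom.naturality f

theorem exchange_comp {W V T : X} (x : W ⟶ V) (y : V ⟶ T) (z : W ⟶ T) (h : x ≫ y = z)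
    (B : P.obj T) :
    (P.map (snd U W)).map ((P.mapComp x y z h).hom.app B) ≫ (exchange U z B).hom =
      (exchange U x _).hom ≫ (P.map (infMap U x)).map (exchange U y B).hom ≫
        (P.mapComp (infMap U x) (infMap U y) (infMap U z) (Subsingleton.elim _ _)).hom.app _ := by
  have h₃ := P.assoc (infMap U x) (infMap U y) (snd U T) (infMap U z) (diag U y) (diag U z)
    (Subsingleton.elim _ _) (Subsingleton.elim _ _) (Subsingleton.elim _ _)
    (Subsingleton.elim _ _) B
  have h₄ := P.assoc (infMap U x) (snd U V) y (diag U x) (diag U y) (diag U z)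
    (Subsingleton.elim _ _) (Subsingleton.elim _ _) (Subsingleton.elim _ _)
    (Subsingleton.elim _ _) B
  have h₅ := P.assoc (snd U W) x y (diag U x) z (diag U z)
    (Subsingleton.elim _ _) (Subsingleton.elim _ _) (Subsingleton.elim _ _)
    (Subsingleton.elim _ _) B
  rw [← cancel_mono ((P.mapComp (infMap U z) (snd U T) (diag U z)
    (Subsingleton.elim _ _)).hom.app B)]
  simp only [exchange, Iso.trans_hom, Iso.app_hom, Iso.symm_hom, Iso.app_inv, Category.assoc,
    Iso.inv_hom_id_app, Category.comp_id, Functor.map_comp]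
  rw [h₃, ← h₅, ← Functor.map_comp_assoc _ _ ((P.mapComp (infMap U y) _ _ _).hom.app B),
    Iso.inv_hom_id_app]
  erw [CategoryTheory.Functor.map_id, Category.id_comp]
  rw [← h₄, Iso.inv_hom_id_app_assoc]

theorem restr_comp {W V T : X} (x : W ⟶ V) (y : V ⟶ T) (z : W ⟶ T)
    (M : P.obj U) :
    (P.map (infMap U x)).map (restr U y M).hom ≫ (restr U x M).hom =
      (P.mapComp (infMap U x) (infMap U y) (infMap U z) (Subsingleton.elim _ _)).hom.app _ ≫
        (restr U z M).hom :=
  (P.assoc (infMap U x) (infMap U y) (fst U T) (infMap U z) (fst U V) (fst U W)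
    (Subsingleton.elim _ _) (Subsingleton.elim _ _) (Subsingleton.elim _ _)
    (Subsingleton.elim _ _) M).symm

/-- The adjoint of `gluing`. -/
noncomputable def gluingAdj {W V : X} (x : W ⟶ V) (M : P.obj U) :
    (P.map (snd U W)).obj ((P.map x).obj (R.sec U V M)) ≅ (P.map (fst U W)).obj M :=
  exchange U x _ ≪≫ (P.map (infMap U x)).mapIso (asIso (R.ev U V M)) ≪≫ restr U x M

/-- The transformation `x^* (u_* M)_V ⟶ (u_* M)_W`. -/
noncomputable def gluing {W V : X} (x : W ⟶ V) (M : P.obj U) :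
    (P.map x).obj (R.sec U V M) ⟶ R.sec U W M :=
  (R.adj (snd U W)).homEquiv _ _ (R.gluingAdj U x M).hom

instance {W V : X} (x : W ⟶ V) (M : P.obj U) : IsIso (R.gluing U x M) := by
  have : IsIso ((R.adj (snd U W)).unit.app ((P.map x).obj (R.sec U V M))) :=
    (R.adj (snd U W)).isIso_unit_app_iff_mem_essImage.2 (R.mem_essImage (isPullback_inf U x) _)
  rw [gluing, Adjunction.homEquiv_unit]
  infer_instance

/-- Morphisms `A ⟶ q_* p^* M` are morphisms `q^* A ⟶ p^* M`. -/
noncomputable def secEquiv (W : X) (A : P.obj W) (M : P.obj U) :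
    (A ⟶ R.sec U W M) ≃ ((P.map (snd U W)).obj A ⟶ (P.map (fst U W)).obj M) :=
  ((R.adj (snd U W)).homEquiv _ _).symm

theorem secEquiv_apply {W : X} {A : P.obj W} {M : P.obj U} (f : A ⟶ R.sec U W M) :
    R.secEquiv U W A M f = (P.map (snd U W)).map f ≫ R.ev U W M :=
  (R.adj (snd U W)).homEquiv_counit _ _ f

theorem secEquiv_comp {W : X} {A A' : P.obj W} {M : P.obj U} (g : A' ⟶ A) (f : A ⟶ R.sec U W M) :
    R.secEquiv U W A' M (g ≫ f) = (P.map (snd U W)).map g ≫ R.secEquiv U W A M f := by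
  simp [secEquiv_apply]

theorem secEquiv_gluing {W V : X} (x : W ⟶ V) (M : P.obj U) :
    R.secEquiv U W _ M (R.gluing U x M) = (R.gluingAdj U x M).hom :=
  Equiv.symm_apply_apply _ _

theorem secEquiv_comp_gluing {W V : X} (x : W ⟶ V) {M : P.obj U} {A : P.obj V}
    (f : A ⟶ R.sec U V M) :
    R.secEquiv U W _ M ((P.map x).map f ≫ R.gluing U x M) =
      (exchange U x A).hom ≫ (P.map (infMap U x)).map (R.secEquiv U V A M f) ≫
        (restr U x M).hom := by
  rw [secEquiv_comp, secEquiv_gluing, secEquiv_apply]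
  simp only [gluingAdj, Iso.trans_hom, Functor.mapIso_hom, asIso_hom, Functor.map_comp,
    Category.assoc]
  rw [← Category.assoc, exchange_naturality, Category.assoc]

theorem gluing_comp {W V T : X} (x : W ⟶ V) (y : V ⟶ T) (z : W ⟶ T) (h : x ≫ y = z)
    (M : P.obj U) :
    (P.map x).map (R.gluing U y M) ≫ R.gluing U x M =
      (P.mapComp x y z h).hom.app (R.sec U T M) ≫ R.gluing U z M := by
  apply (R.secEquiv U W _ M).injective
  have h₁ := exchange_comp U x y z h (R.sec U T M)
  have h₂ := (P.mapComp (infMap U x) (infMap U y) (infMap U z)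
    (Subsingleton.elim _ _)).hom.naturality (R.ev U T M)
  simp only [Functor.comp_map] at h₂
  rw [secEquiv_comp_gluing, secEquiv_comp, secEquiv_gluing, secEquiv_gluing]
  simp only [gluingAdj, Iso.trans_hom, Functor.mapIso_hom, asIso_hom, Functor.map_comp,
    Category.assoc]
  rw [reassoc_of% h₁, ← reassoc_of% h₂, restr_comp U x y z]

/-- The map `u_* M ⟶ u_* M'` induced by `f : M ⟶ M'`, over `V`. -/
noncomputable abbrev secMap (V : X) {M M' : P.obj U} (f : M ⟶ M') : R.sec U V M ⟶ R.sec U V M' :=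
  (R.pf (snd U V)).map ((P.map (fst U V)).map f)

theorem secEquiv_comp_secMap {W : X} {A : P.obj W} {M M' : P.obj U} (f : M ⟶ M')
    (g : A ⟶ R.sec U W M) :
    R.secEquiv U W A M' (g ≫ R.secMap U W f) =
      R.secEquiv U W A M g ≫ (P.map (fst U W)).map f :=
  Adjunction.homEquiv_naturality_right_symm _ _ _

theorem gluing_naturality {W V : X} (x : W ⟶ V) {M M' : P.obj U} (f : M ⟶ M') :
    (P.map x).map (R.secMap U V f) ≫ R.gluing U x M' =
      R.gluing U x M ≫ R.secMap U W f := by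
  apply (R.secEquiv U W _ M').injective
  have : R.secEquiv U V _ M' (R.secMap U V f) = R.ev U V M ≫ (P.map (fst U V)).map f := by
    rw [← Category.id_comp (R.secMap U V f), secEquiv_comp_secMap, secEquiv_apply]
    simp
  rw [secEquiv_comp_secMap, secEquiv_comp_gluing, secEquiv_gluing, this]
  simp only [gluingAdj, Iso.trans_hom, Functor.mapIso_hom, asIso_hom, Functor.map_comp,
    Category.assoc, restr_naturality]

/-- The functor `u_{U,*} : C(U) ⥤ Des(C)`. -/
noncomputable def extend : P.obj U ⥤ P.Des where
  obj M := Des.mk (fun V => R.sec U V M) (fun x => asIso (R.gluing U x M))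
    fun x y z h => R.gluing_comp U x y z h M
  map f := Des.homMk (fun V => R.secMap U V f) fun x => R.gluing_naturality U x f
  map_id M := Des.hom_ext fun V => (P.map (fst U V) ⋙ R.pf (snd U V)).map_id M
  map_comp f g := Des.hom_ext fun V => (P.map (fst U V) ⋙ R.pf (snd U V)).map_comp f g

end Pushforwards
end KPrestack

namespace KPrestack

variable {k : Type w} [CommRing k] {X : Type v} [SemilatticeInf X] {P : KPrestack.{v, u} k X}

namespace Pushforwards

variable (R : P.Pushforwards) (U : X)

theorem extend_hom_ext {B : P.Des} {M : P.obj U} {g g' : B ⟶ (R.extend U).obj M}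
    (h : (P.proj U).map g = (P.proj U).map g') : g = g' := by
  refine Des.hom_ext fun V => (R.secEquiv U V _ M).injective ?_
  have h₁ : (P.proj (U ⊓ V)).map g = (P.proj (U ⊓ V)).map g' := by
    rw [← cancel_epi ((P.projComp (fst U V)).hom.app B), ← Des.map_proj_map, h, Des.map_proj_map]
  have h₂ : (P.map (snd U V)).map ((P.proj V).map g) =
      (P.map (snd U V)).map ((P.proj V).map g') := by
    rw [← cancel_mono ((P.projComp (snd U V)).hom.app ((R.extend U).obj M)), Des.map_proj_map,
      h₁, Des.map_proj_map]
  exact (R.secEquiv_apply U _).trans ((congrArg (· ≫ _) h₂).trans (R.secEquiv_apply U _).symm)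

/-- For a descent datum `B`, the isomorphism `q^* B_V ≅ p^* B_U`. -/
noncomputable def swap (B : P.Des) (V : X) :
    (P.map (snd U V)).obj ((P.proj V).obj B) ≅ (P.map (fst U V)).obj ((P.proj U).obj B) :=
  (P.projComp (snd U V)).app B ≪≫ ((P.projComp (fst U V)).app B).symm

theorem exchange_swap_restr (B : P.Des) {W V : X} (x : W ⟶ V) :
    (exchange U x _).hom ≫ (P.map (infMap U x)).map (swap U B V).hom ≫ (restr U x _).hom =
      (P.map (snd U W)).map ((P.projComp x).hom.app B) ≫ (swap U B W).hom := by
  have h₁ := Des.projComp_comp B (snd U W) x (diag U x) (Subsingleton.elim _ _)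
  have h₂ := Des.projComp_comp B (infMap U x) (snd U V) (diag U x) (Subsingleton.elim _ _)
  have h₃ := Des.projComp_comp B (infMap U x) (fst U V) (fst U W) (Subsingleton.elim _ _)
  rw [← cancel_mono ((P.projComp (fst U W)).hom.app B)]
  simp only [exchange, restr, swap, Iso.trans_hom, Iso.app_hom, Iso.symm_hom, Iso.app_inv,
    Category.assoc, Functor.map_comp, Iso.inv_hom_id_app, Category.comp_id]
  rw [← h₃, ← Functor.map_comp_assoc _ ((P.projComp (fst U V)).inv.app B), Iso.inv_hom_id_app]
  erw [CategoryTheory.Functor.map_id, Category.id_comp]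
  rw [h₁, h₂, Iso.inv_hom_id_app_assoc]

/-- The components of the morphism `B ⟶ u_{U,*} M` given by a morphism `B_U ⟶ M`. -/
noncomputable def toSec {B : P.Des} {M : P.obj U} (f : (P.proj U).obj B ⟶ M) (V : X) :
    (P.proj V).obj B ⟶ R.sec U V M :=
  (R.secEquiv U V _ M).symm ((swap U B V).hom ≫ (P.map (fst U V)).map f)

theorem secEquiv_toSec {B : P.Des} {M : P.obj U} (f : (P.proj U).obj B ⟶ M) (V : X) :
    R.secEquiv U V _ M (R.toSec U f V) = (swap U B V).hom ≫ (P.map (fst U V)).map f :=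
  Equiv.apply_symm_apply _ _

theorem toSec_gluing {B : P.Des} {M : P.obj U} (f : (P.proj U).obj B ⟶ M) {W V : X} (x : W ⟶ V) :
    (P.map x).map (R.toSec U f V) ≫ R.gluing U x M =
      (P.projComp x).hom.app B ≫ R.toSec U f W := by
  apply (R.secEquiv U W _ M).injective
  have h := exchange_swap_restr U B x
  rw [secEquiv_comp_gluing, secEquiv_comp, secEquiv_toSec, secEquiv_toSec, Functor.map_comp,
    Category.assoc, restr_naturality, reassoc_of% h]

theorem toSec_comp {B B' : P.Des} {M : P.obj U} (g : B' ⟶ B) (f : (P.proj U).obj B ⟶ M) (V : X) :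
    R.toSec U ((P.proj U).map g ≫ f) V = (P.proj V).map g ≫ R.toSec U f V := by
  apply (R.secEquiv U V _ M).injective
  have h₁ := (P.projComp (snd U V)).hom.naturality g
  have h₂ := (P.projComp (fst U V)).inv.naturality g
  simp only [Functor.comp_map] at h₁ h₂
  rw [secEquiv_comp, secEquiv_toSec, secEquiv_toSec]
  simp only [swap, Iso.trans_hom, Iso.app_hom, Iso.symm_hom, Iso.app_inv, Functor.map_comp,
    Category.assoc]
  rw [reassoc_of% h₁, reassoc_of% h₂]

theorem toSec_secMap {B : P.Des} {M M' : P.obj U} (f : (P.proj U).obj B ⟶ M) (g : M ⟶ M')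
    (V : X) : R.toSec U (f ≫ g) V = R.toSec U f V ≫ R.secMap U V g := by
  apply (R.secEquiv U V _ M').injective
  rw [secEquiv_comp_secMap, secEquiv_toSec, secEquiv_toSec, Functor.map_comp, Category.assoc]

/-- The morphism `B ⟶ u_{U,*} M` given by a morphism `B_U ⟶ M`. -/
noncomputable def toExtend {B : P.Des} {M : P.obj U} (f : (P.proj U).obj B ⟶ M) :
    B ⟶ (R.extend U).obj M :=
  Des.homMk (R.toSec U f) (R.toSec_gluing U f)

/-- The adjunction bijection for `u_{U,*}`. -/
noncomputable def extendEquiv (B : P.Des) (M : P.obj U) :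
    ((P.proj U).obj B ⟶ M) ≃ (B ⟶ (R.extend U).obj M) :=
  Equiv.ofBijective (R.toExtend U) (by
    obtain ⟨_, _⟩ := full_faithful_of_le (P := P) (fst U U) (le_inf le_rfl le_rfl)
    constructor
    · intro f f' h
      have h' : R.toSec U f U = R.toSec U f' U := congrArg (P.proj U).map h
      replace h' := congrArg (R.secEquiv U U _ M) h'
      rw [secEquiv_toSec, secEquiv_toSec, cancel_epi] at h'
      exact (P.map (fst U U)).map_injective h'
    · intro g
      refine ⟨(P.map (fst U U)).preimage ((swap U B U).inv ≫
        R.secEquiv U U _ M ((P.proj U).map g)), R.extend_hom_ext U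
          ((R.secEquiv U U _ M).injective ?_)⟩
      refine (R.secEquiv_toSec U _ U).trans ?_
      rw [Functor.map_preimage, Iso.hom_inv_id_assoc])

/-- `u_{U,*}` is right adjoint to `π_U`. -/
noncomputable def extendAdj : P.proj U ⊣ R.extend U :=
  Adjunction.mkOfHomEquiv
    { homEquiv := R.extendEquiv U
      homEquiv_naturality_left_symm := fun {B B' M} f g => by
        rw [Equiv.symm_apply_eq]
        refine Des.hom_ext fun V => ?_
        have h : g = R.toExtend U ((R.extendEquiv U B' M).symm g) :=
          ((R.extendEquiv U B' M).apply_symm_apply g).symm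
        conv_lhs => rw [h]
        exact (R.toSec_comp U f _ V).symm
      homEquiv_naturality_right := fun {B M M'} f g => by
        exact Des.hom_ext fun V => R.toSec_secMap U f g V }

instance extend_faithful : (R.extend U).Faithful where
  map_injective {M M'} f f' h := by
    obtain ⟨_, _⟩ := full_faithful_of_le (P := P) (fst U U) (le_inf le_rfl le_rfl)
    exact (P.map (fst U U) ⋙ R.pf (snd U U)).map_injective (congrArg (P.proj U).map h)

instance extend_full : (R.extend U).Full where
  map_surjective {M M'} g := by
    obtain ⟨_, _⟩ := full_faithful_of_le (P := P) (fst U U) (le_inf le_rfl le_rfl)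
    obtain ⟨f, hf⟩ := (P.map (fst U U) ⋙ R.pf (snd U U)).map_surjective ((P.proj U).map g)
    exact ⟨f, R.extend_hom_ext U hf⟩

theorem extend_isExact (hP : ∀ {V U : X} (u : V ⟶ U), IsExactFunctor (P.map u)) :
    IsExactFunctor (R.extend U) := by
  have h₁ V := (hP (fst U V)).1
  have h₂ V := (hP (fst U V)).2
  have h₃ V := (R.exact (snd U V)).1
  have h₄ V := (R.exact (snd U V)).2
  refine ⟨⟨fun J _ _ => ⟨fun {F} => ⟨fun {c} hc => ⟨Des.isLimitOfProj _ fun V => ?_⟩⟩⟩⟩,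
    ⟨fun J _ _ => ⟨fun {F} => ⟨fun {c} hc => ⟨?_⟩⟩⟩⟩⟩
  · exact isLimitOfPreserves (P.map (fst U V) ⋙ R.pf (snd U V)) hc
  · have {V U : X} (u : V ⟶ U) : PreservesColimitsOfShape J (P.map u) := by
      have := (hP u).2
      infer_instance
    exact Des.isColimitOfProj _ fun V =>
      isColimitOfPreserves (P.map (fst U V) ⋙ R.pf (snd U V)) hc

end Pushforwards
end KPrestack

namespace KPrestack

section BaseChange

variable {k : Type w} [CommRing k] {X : Type w₁} [Category.{w₂} X] {P : KPrestack.{v, u} k X}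
  {Q V W U : X} {w₁ : Q ⟶ V} {v₁ : Q ⟶ W} {v : V ⟶ U} {w : W ⟶ U}
  {Rv : P.obj V ⥤ P.obj U} {Rv₁ : P.obj Q ⥤ P.obj W}

theorem isIso_baseChange (av : P.map v ⊣ Rv) (av₁ : P.map v₁ ⊣ Rv₁)
    (sq : CommSq w₁ v₁ v w) [Rv.Full] [Rv.Faithful] [Rv₁.Full]
    [Rv₁.Faithful] (h : ∀ B, Rv₁.essImage ((P.map w).obj (Rv.obj B))) :
    IsIso (P.baseChange sq av av₁) := by
  rw [NatTrans.isIso_iff_isIso_app]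
  intro B
  have : IsIso (av₁.unit.app ((P.map w).obj (Rv.obj B))) :=
    av₁.isIso_unit_app_iff_mem_essImage.2 (h B)
  simp only [baseChange, mateEquiv_apply]
  dsimp
  infer_instance

theorem nonempty_iso_of_mem_essImage (av : P.map v ⊣ Rv) (av₁ : P.map v₁ ⊣ Rv₁)
    (sq : CommSq w₁ v₁ v w) [Rv.Full] [Rv.Faithful] [Rv₁.Full]
    [Rv₁.Faithful] (h : ∀ B, Rv₁.essImage ((P.map w).obj (Rv.obj B)))
    {Rw : P.obj W ⥤ P.obj U} (aw : P.map w ⊣ Rw) {u : Q ⟶ U} (hu : w₁ ≫ v = u)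
    {Ru : P.obj Q ⥤ P.obj U} (au : P.map u ⊣ Ru) :
    Nonempty ((P.map v ⋙ Rv) ⋙ (P.map w ⋙ Rw) ≅ P.map u ⋙ Ru) := by
  have := isIso_baseChange av av₁ sq h
  let e₁ : Rv ⋙ P.map w ≅ P.map w₁ ⋙ Rv₁ := asIso (P.baseChange sq av av₁)
  let e₂ : Ru ≅ Rv₁ ⋙ Rw := au.rightAdjointUniq
    ((aw.comp av₁).ofNatIsoLeft (P.mapComp v₁ w u (sq.w.symm.trans hu)))
  exact ⟨Functor.isoWhiskerLeft (P.map v) (Functor.isoWhiskerRight e₁ Rw) ≪≫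
    Functor.isoWhiskerRight (P.mapComp w₁ v u hu) (Rv₁ ⋙ Rw) ≪≫
      Functor.isoWhiskerLeft (P.map u) e₂.symm⟩

theorem mem_essImage_congr (av : P.map v ⊣ Rv) (av₁ : P.map v₁ ⊣ Rv₁)
    {Rv' : P.obj V ⥤ P.obj U} (av' : P.map v ⊣ Rv')
    {Rv₁' : P.obj Q ⥤ P.obj W} (av₁' : P.map v₁ ⊣ Rv₁') {B : P.obj V}
    (h : Rv₁'.essImage ((P.map w).obj (Rv'.obj B))) :
    Rv₁.essImage ((P.map w).obj (Rv.obj B)) :=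
  (Functor.essImage.ofIso ((P.map w).mapIso ((av'.rightAdjointUniq av).app B)) h).ofNatIso
    (av₁'.rightAdjointUniq av₁)

end BaseChange

section Star

variable {k : Type w} [CommRing k] {X : Type v} [SemilatticeInf X]
  {C : KPrestack.{v, max u v} k X}

theorem isPullback_of_le {Q V W U : X} (w₁ : Q ⟶ V) (v₁ : Q ⟶ W) (v : V ⟶ U) (w : W ⟶ U)
    (h : ∀ T, T ≤ V → T ≤ W → T ≤ Q) : IsPullback w₁ v₁ v w :=
  ⟨⟨Subsingleton.elim _ _⟩, ⟨PullbackCone.IsLimit.mk _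
    (fun s => homOfLE (h _ s.fst.le s.snd.le))
    (fun _ => Subsingleton.elim _ _) (fun _ => Subsingleton.elim _ _)
    (fun _ _ _ _ => Subsingleton.elim _ _)⟩⟩

theorem essImage_of_le {Y : Type w₁} [PartialOrder Y] {P : KPrestack.{v, u} k Y} {Q W : Y}
    {v₁ : Q ⟶ W} (h : W ≤ Q) {Rv₁ : P.obj Q ⥤ P.obj W} (av₁ : P.map v₁ ⊣ Rv₁) (B : P.obj W) :
    Rv₁.essImage B := by
  obtain rfl := le_antisymm v₁.le h
  obtain rfl := Subsingleton.elim v₁ (𝟙 Q)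
  exact ⟨B, ⟨((Adjunction.id.ofNatIsoLeft (P.mapId Q)).rightAdjointUniq av₁).symm.app B⟩⟩

namespace Pushforwards

theorem mem_essImage_star (R : C.Pushforwards) {Q V W U : WithTop X} (w₁ : Q ⟶ V) (v₁ : Q ⟶ W) (v : V ⟶ U) (w : W ⟶ U)
    (h : ∀ T, T ≤ V → T ≤ W → T ≤ Q) {Rv : C.star.obj V ⥤ C.star.obj U} (av : C.star.map v ⊣ Rv)
    {Rv₁ : C.star.obj Q ⥤ C.star.obj W} (av₁ : C.star.map v₁ ⊣ Rv₁) (B : C.star.obj V) :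
    Rv₁.essImage ((C.star.map w).obj (Rv.obj B)) := by
  by_cases hV : W ≤ V
  · exact essImage_of_le (h _ hV le_rfl) av₁ _
  by_cases hW : U ≤ W
  · obtain rfl := le_antisymm w.le hW
    obtain rfl := le_antisymm w₁.le (h V le_rfl v.le)
    obtain rfl := Subsingleton.elim w (𝟙 W)
    obtain rfl := Subsingleton.elim v v₁
    exact ((Rv.obj_mem_essImage B).ofIso ((C.star.mapId W).app _)).ofNatIso
      (av.rightAdjointUniq av₁)
  match Q, V, W, U, w₁, v₁, v, w with
  | _, ⊤, _, _, _, _, _, _ => exact (hV le_top).elim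
  | _, _, ⊤, _, _, _, _, _ => exact (hW le_top).elim
  | ⊤, (V : X), _, _, w₁, _, _, _ => exact (not_top_hom w₁).elim
  | (Q : X), (V : X), (W : X), (U : X), w₁, v₁, v, w =>
    exact mem_essImage_congr av av₁ (R.adj (ofCoe v)) (R.adj (ofCoe v₁))
      (R.mem_essImage (isPullback_of_le (ofCoe w₁) (ofCoe v₁) (ofCoe v) (ofCoe w) fun T h₁ h₂ =>
        WithTop.coe_le_coe.1 (h T (WithTop.coe_le_coe.2 h₁) (WithTop.coe_le_coe.2 h₂))) B)
  | (Q : X), (V : X), (W : X), ⊤, w₁, v₁, v, w =>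
    obtain rfl : Q = V ⊓ W := le_antisymm (le_inf (ofCoe w₁).le (ofCoe v₁).le)
      (WithTop.coe_le_coe.1 (h (V ⊓ W : X) (WithTop.coe_le_coe.2 inf_le_left)
        (WithTop.coe_le_coe.2 inf_le_right)))
    exact mem_essImage_congr av av₁ (R.extendAdj V) (R.adj (ofCoe v₁))
      ((R.pf (snd V W)).obj_mem_essImage ((C.map (fst V W)).obj B))

theorem exists_star_adjoint (R : C.Pushforwards) (hC : C.IsAffineLocalization) {V U : WithTop X} (v : V ⟶ U) :
    ∃ Rv : C.star.obj V ⥤ C.star.obj U, Nonempty (C.star.map v ⊣ Rv) ∧ Rv.Full ∧ Rv.Faithful ∧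
      IsExactFunctor Rv :=
  match V, U, v with
  | ⊤, ⊤, _ => ⟨𝟭 _, ⟨Adjunction.id⟩, inferInstance, inferInstance, inferInstance, inferInstance⟩
  | (V : X), ⊤, _ => ⟨R.extend V, ⟨R.extendAdj V⟩, R.extend_full V, R.extend_faithful V,
      R.extend_isExact V hC.exact⟩
  | (_ : X), (_ : X), v => ⟨R.pf (ofCoe v), ⟨R.adj _⟩, R.full _, R.faithful _, R.exact _⟩
  | ⊤, (_ : X), v => (not_top_hom v).elim

end Pushforwards

theorem IsAffineLocalization.isGrothendieck_des (hC : C.IsAffineLocalization) :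
    C.Des.IsGrothendieck := by
  obtain ⟨R⟩ := hC.nonempty_pushforwards
  have (U : X) : (C.obj U).Grothendieck := ⟨hC.grothendieck U⟩
  have {V U : X} (u : V ⟶ U) : PreservesFiniteLimits (C.map u) := (hC.exact u).1
  have {V U : X} (u : V ⟶ U) : PreservesColimitsOfSize.{v, v} (C.map u) :=
    (R.adj u).leftAdjoint_preservesColimits
  exact Des.isGrothendieck

theorem IsAffineLocalization.isExactFunctor_proj (hC : C.IsAffineLocalization) (U : X) :
    IsExactFunctor (C.proj U) := by
  obtain ⟨R⟩ := hC.nonempty_pushforwards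
  have (U : X) : (C.obj U).Grothendieck := ⟨hC.grothendieck U⟩
  have {V U : X} (u : V ⟶ U) : PreservesFiniteLimits (C.map u) := (hC.exact u).1
  have {V U : X} (u : V ⟶ U) : PreservesColimitsOfSize.{v, v} (C.map u) :=
    (R.adj u).leftAdjoint_preservesColimits
  exact ⟨inferInstance, inferInstance⟩

theorem IsAffineLocalization.star (hC : C.IsAffineLocalization) :
    C.star.IsAffineLocalization := by
  obtain ⟨R⟩ := hC.nonempty_pushforwards
  choose S hS using fun {V U : WithTop X} (v : V ⟶ U) => R.exists_star_adjoint hC v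
  have hF {V U : WithTop X} (v : V ⟶ U) : (S v).Full := (hS v).2.1
  have hf {V U : WithTop X} (v : V ⟶ U) : (S v).Faithful := (hS v).2.2.1
  refine ⟨fun U => ?_, fun {V U} v => ?_, S, hS, fun {Q V W U} w₁ v₁ v w sq u hu => ?_⟩
  · match U with
    | ⊤ => exact hC.isGrothendieck_des
    | (U : X) => exact hC.grothendieck U
  · match V, U, v with
    | ⊤, ⊤, v => exact ⟨inferInstanceAs (PreservesFiniteLimits (𝟭 _)),
        inferInstanceAs (PreservesFiniteColimits (𝟭 _))⟩
    | (V : X), ⊤, v => exact hC.isExactFunctor_proj V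
    | (_ : X), (_ : X), v => exact hC.exact (ofCoe v)
    | ⊤, (_ : X), v => exact (not_top_hom v).elim
  · have h T (h₁ : T ≤ V) (h₂ : T ≤ W) : T ≤ Q :=
      (sq.lift (homOfLE h₁) (homOfLE h₂) (Subsingleton.elim _ _)).le
    exact ⟨nonempty_iso_of_mem_essImage (hS w).1.some (hS w₁).1.some sq.toCommSq.flip
        (R.mem_essImage_star v₁ w₁ w v (fun T h₁ h₂ => h T h₂ h₁) (hS w).1.some (hS w₁).1.some)
        (hS v).1.some (sq.w.symm.trans hu) (hS u).1.some,
      nonempty_iso_of_mem_essImage (hS v).1.some (hS v₁).1.some sq.toCommSq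
        (R.mem_essImage_star w₁ v₁ v w h (hS v).1.some (hS v₁).1.some)
        (hS w).1.some hu (hS u).1.some⟩

theorem IsAffineLocalization.isIso_baseChange_star (hC : C.IsAffineLocalization) {Q V W U : WithTop X}
    {w₁ : Q ⟶ V} {v₁ : Q ⟶ W} {v : V ⟶ U} {w : W ⟶ U}
    (h : ∀ T, T ≤ V → T ≤ W → T ≤ Q) (sq : CommSq w₁ v₁ v w)
    {Rv : C.star.obj V ⥤ C.star.obj U} (av : C.star.map v ⊣ Rv)
    {Rv₁ : C.star.obj Q ⥤ C.star.obj W} (av₁ : C.star.map v₁ ⊣ Rv₁) :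
    IsIso (C.star.baseChange sq av av₁) := by
  obtain ⟨R⟩ := hC.nonempty_pushforwards
  obtain ⟨Sv, ⟨a⟩, _, _, _⟩ := R.exists_star_adjoint hC v
  obtain ⟨Sv₁, ⟨a₁⟩, _, _, _⟩ := R.exists_star_adjoint hC v₁
  have := Functor.Full.of_iso (a.rightAdjointUniq av)
  have := Functor.Faithful.of_iso (a.rightAdjointUniq av)
  have := Functor.Full.of_iso (a₁.rightAdjointUniq av₁)
  have := Functor.Faithful.of_iso (a₁.rightAdjointUniq av₁)
  exact isIso_baseChange av av₁ sq (R.mem_essImage_star w₁ v₁ v w h av av₁)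

end Star
end KPrestack

namespace KLinCat

variable {k : Type w} [CommRing k]

/-- Flatness descends along a finite, jointly faithful family of functors with right adjoints that
preserve epimorphisms. -/
theorem IsFlat.of_adjunctions {ι : Type w₁} [Finite ι] {D : KLinCat.{v, u} k} [D.Grothendieck]
    {C : ι → KLinCat.{v, u} k} {F : ∀ i, D ⥤ C i} {G : ∀ i, C i ⥤ D} (adj : ∀ i, F i ⊣ G i)
    [∀ i, (F i).Additive] [∀ i, (F i).Linear k] [∀ i, (G i).PreservesEpimorphisms]
    (hF : ∀ {A B : D} (f g : A ⟶ B), (∀ i, (F i).map f = (F i).map g) → f = g)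
    (h : ∀ i, (C i).IsFlat) : D.IsFlat := by
  intro n K hK A
  choose A' j hj H using fun i => h i n K hK ((F i).obj A)
  let e i B M := (adj i).homEquiv B M
  have he i {B' B M} (f : B' ⟶ B) (g : (F i).obj B ⟶ M) :
      f ≫ e i B M g = e i B' M ((F i).map f ≫ g) :=
    ((adj i).homEquiv_naturality_left f g).symm
  have he_counit i {B M} (f : (F i).obj B ⟶ M) :
      (F i).map (e i B M f) ≫ (adj i).counit.app M = f :=
    (adj i).homEquiv_counit .. ▸ (e i B M).symm_apply_apply f
  have he_add i {B M} (f g : (F i).obj B ⟶ M) : e i B M (f + g) = e i B M f + e i B M g := by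
    rw [← Equiv.eq_symm_apply, Adjunction.homEquiv_counit, Functor.map_add,
      Preadditive.add_comp, he_counit, he_counit]
  have he_smul i {B M} (r : k) (f : (F i).obj B ⟶ M) : e i B M (r • f) = r • e i B M f := by
    rw [← Equiv.eq_symm_apply, Adjunction.homEquiv_counit, Functor.map_smul,
      Linear.smul_comp, he_counit]
  refine ⟨∏ᶜ fun i => (G i).obj (A' i), Limits.Pi.lift fun i => e i A (A' i) (j i), ⟨fun f g hfg => ?_⟩,
    fun T y => ?_⟩
  · refine hF f g fun i => ?_
    have := congrArg (· ≫ Limits.Pi.π _ i) hfg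
    simp only [Category.assoc, Limits.Pi.lift_π, he] at this
    exact (cancel_mono (j i)).1 ((e i _ _).injective this)
  choose T' p hp x hx using fun i => H i ((F i).obj T) (((F i).mapLinearMap k).comp y)
  let q : (∏ᶜ fun i => (G i).obj (T' i)) ⟶ ∏ᶜ fun i => (G i).obj ((F i).obj T) :=
    Limits.Pi.map fun i => (G i).map (p i)
  let τ : T ⟶ ∏ᶜ fun i => (G i).obj ((F i).obj T) := Limits.Pi.lift fun i => (adj i).unit.app T
  let s i : (F i).obj (pullback τ q) ⟶ T' i :=
    (F i).map (pullback.snd τ q ≫ Limits.Pi.π _ i) ≫ (adj i).counit.app (T' i)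
  have hs i : s i ≫ p i = (F i).map (pullback.fst τ q) := by
    have h₁ := congrArg (· ≫ Limits.Pi.π _ i) (pullback.condition (f := τ) (g := q))
    simp only [Category.assoc, τ, q, Limits.Pi.lift_π, Limits.Pi.map_π] at h₁
    have h₂ := (adj i).counit.naturality (p i)
    simp only [Functor.comp_map, Functor.id_map] at h₂
    simp only [s, Category.assoc, ← h₂]
    rw [← Functor.map_comp_assoc, Category.assoc, ← h₁]
    simp [τ, q]
  have : HasFiniteBiproducts D := HasFiniteBiproducts.of_hasFiniteProducts
  have : Epi q := Limits.Pi.map_epi _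
  refine ⟨pullback τ q, pullback.fst τ q, inferInstance,
    { toFun := fun a => Limits.Pi.lift fun i => e i _ _ (s i ≫ x i a)
      map_add' := fun a b => Limits.Pi.hom_ext _ _ fun i => ?_
      map_smul' := fun r a => Limits.Pi.hom_ext _ _ fun i => ?_ }, fun a => Limits.Pi.hom_ext _ _ fun i => ?_⟩
  · simp [he_add]
  · simp [he_smul]
  · simp [he, hx, reassoc_of% (hs i)]

end KLinCat

theorem KPrestack.IsAffineLocalization.isFlat_des {k : Type w} [CommRing k] {X : Type v}
    [SemilatticeInf X] [Finite X] {C : KPrestack.{v, max u v} k X} (hC : C.IsAffineLocalization)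
    (h : ∀ U, (C.obj U).IsFlat) : C.Des.IsFlat := by
  obtain ⟨R⟩ := hC.nonempty_pushforwards
  have : C.Des.Grothendieck := ⟨hC.isGrothendieck_des⟩
  have (U : X) : (R.extend U).PreservesEpimorphisms := by
    have := (R.extend_isExact U hC.exact).2
    infer_instance
  exact KLinCat.IsFlat.of_adjunctions R.extendAdj (fun f g hfg => Des.hom_ext hfg) h

/-- Extensions along a jointly epimorphic family of generalized elements suffice for coflatness. -/
theorem KLinCat.isCoflat_of_family {k : Type w} [CommRing k] {D : KLinCat.{v, u} k}
    [HasCoproducts.{u'} D] {E : D}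
    (h : ∀ (n : ℕ) (K : Submodule k (Fin n → k)) (T : D) (y : K →ₗ[k] (T ⟶ E)),
      ∃ (I : Type u') (P : I → D) (p : ∀ i, P i ⟶ T),
        (∀ {Z : D} (f g : T ⟶ Z), (∀ i, p i ≫ f = p i ≫ g) → f = g) ∧
          ∀ i, ∃ x : (Fin n → k) →ₗ[k] (P i ⟶ E), ∀ a : K, x a = p i ≫ y a) :
    D.IsCoflat E := by
  intro n K hK T y
  obtain ⟨I, P, p, hp, hx⟩ := h n K T y
  choose x hx using hx
  refine ⟨∐ P, Limits.Sigma.desc p, ⟨fun f g hfg => hp f g fun i => ?_⟩,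
    { toFun := fun m => Limits.Sigma.desc fun i => x i m
      map_add' := fun m m' => Limits.Sigma.hom_ext _ _ fun i => by simp
      map_smul' := fun r m => Limits.Sigma.hom_ext _ _ fun i => by simp },
    fun m => Limits.Sigma.hom_ext _ _ fun i => by simp [hx]⟩
  simpa using congrArg (Limits.Sigma.ι P i ≫ ·) hfg

namespace KMod

open scoped TensorProduct

variable {k : Type v} [CommRing k] {a : KLinCat.{v, v} k}

theorem linPsh_hom_ext {F G : LinPsh a} {f g : F ⟶ G}
    (h : ∀ (A : a) (x : F.obj.obj (.op A)), f.hom.app (.op A) x = g.hom.app (.op A) x) : f = g := by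
  apply ObjectProperty.hom_ext
  ext A x
  exact h A.unop x

/-- The module `M ⊗_k a(-, B)`. -/
noncomputable def tens (M : Type v) [AddCommGroup M] [Module k M] (B : a) : LinPsh a where
  obj :=
    { obj := fun A => ModuleCat.of k (M ⊗[k] (A.unop ⟶ B))
      map := fun f => ModuleCat.ofHom (LinearMap.lTensor M (Linear.leftComp k B f.unop))
      map_id := fun A => by
        ext : 1
        exact TensorProduct.ext' fun m f => by simp
      map_comp := fun f g => by
        ext : 1
        exact TensorProduct.ext' fun m h => by simp }
  property A A' := ⟨fun f g => by
      ext : 1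
      exact TensorProduct.ext' fun m h => by simp [TensorProduct.tmul_add],
    fun r f => by
      ext : 1
      exact TensorProduct.ext' fun m h => by simp⟩

section

variable {M N : Type v} [AddCommGroup M] [Module k M] [AddCommGroup N] [Module k N] (B : a)

/-- The map `M ⊗_k a(-, B) ⟶ N ⊗_k a(-, B)` induced by `M → N`. -/
noncomputable def tensMap (φ : M →ₗ[k] N) : tens M B ⟶ tens N B :=
  ObjectProperty.homMk
    { app := fun A => ModuleCat.ofHom (LinearMap.rTensor (A.unop ⟶ B) φ)
      naturality := fun A A' f => by
        ext : 1
        exact TensorProduct.ext' fun m h => rfl }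

theorem mono_tensMap (h : ∀ A : a, Module.Flat k (A ⟶ B)) {φ : M →ₗ[k] N}
    (hφ : Function.Injective φ) : Mono (tensMap B φ) where
  right_cancellation {F} f g hfg := linPsh_hom_ext fun A x => by
    have := h A
    exact Module.Flat.rTensor_preserves_injective_linearMap (M := A ⟶ B) φ hφ
      (congrArg (fun t => t.hom.app (.op A) x) hfg)

variable {B} in
/-- The morphism `M ⊗_k a(-, B) ⟶ E` induced by `M → E(B)`. -/
noncomputable def tensLift {E : LinPsh a} (φ : M →ₗ[k] E.obj.obj (.op B)) : tens M B ⟶ E :=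
  ObjectProperty.homMk
    { app := fun A => ModuleCat.ofHom (TensorProduct.lift (LinearMap.mk₂ k
        (fun m (f : A.unop ⟶ B) => E.obj.map f.op (φ m))
        (fun m m' f => by rw [map_add, map_add])
        (fun r m f => by rw [map_smul, map_smul])
        (fun m f g => by rw [(E.property (A := A.unop) (B := B)).1]; rfl)
        (fun r m f => by rw [(E.property (A := A.unop) (B := B)).2]; rfl)))
      naturality := fun A A' f => by
        ext : 1
        refine TensorProduct.ext' fun m h => ?_
        change E.obj.map (f.unop ≫ h).op (φ m) = E.obj.map f (E.obj.map h.op (φ m))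
        rw [op_comp, E.obj.map_comp]
        rfl }

theorem tensLift_app_tmul {E : LinPsh a} (φ : M →ₗ[k] E.obj.obj (.op B)) {A : a} (m : M)
    (f : A ⟶ B) : (tensLift φ).hom.app (.op A) (m ⊗ₜ[k] f : M ⊗[k] (A ⟶ B)) =
      E.obj.map f.op (φ m) := rfl

theorem tensLift_app_id {E : LinPsh a} (φ : M →ₗ[k] E.obj.obj (.op B)) (m : M) :
    (tensLift φ).hom.app (.op B) (m ⊗ₜ[k] 𝟙 B : M ⊗[k] (B ⟶ B)) = φ m := by
  rw [tensLift_app_tmul, op_id, E.obj.map_id]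
  rfl

theorem tens_hom_ext {E : LinPsh a} {f g : tens M B ⟶ E}
    (h : ∀ m, f.hom.app (.op B) (m ⊗ₜ[k] 𝟙 B : M ⊗[k] (B ⟶ B)) =
      g.hom.app (.op B) (m ⊗ₜ[k] 𝟙 B : M ⊗[k] (B ⟶ B))) : f = g := by
  apply ObjectProperty.hom_ext
  ext A : 3
  refine TensorProduct.ext' fun m u => ?_
  have key (f : tens M B ⟶ E) : f.hom.app A (m ⊗ₜ[k] u : M ⊗[k] (A.unop ⟶ B)) =
      E.obj.map u.op (f.hom.app (.op B) (m ⊗ₜ[k] 𝟙 B : M ⊗[k] (B ⟶ B))) := by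
    have := congrArg (fun t => t.hom (m ⊗ₜ[k] 𝟙 B : M ⊗[k] (B ⟶ B))) (f.hom.naturality u.op)
    refine Eq.trans ?_ this
    change _ = f.hom.app A (m ⊗ₜ[k] (u ≫ 𝟙 B) : M ⊗[k] (A.unop ⟶ B))
    rw [Category.comp_id]
  exact (key f).trans ((congrArg _ (h m)).trans (key g).symm)

end

/-- The morphism `a(-, B) ⟶ E` given by an element of `E(B)`. -/
noncomputable def ofElement {E : LinPsh a} {B : a} (x : E.obj.obj (.op B)) : tens k B ⟶ E :=
  tensLift (LinearMap.toSpanSingleton k _ x)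

theorem ofElement_app {E : LinPsh a} {B : a} (x : E.obj.obj (.op B)) (r : k) :
    (ofElement x).hom.app (.op B) (r ⊗ₜ[k] 𝟙 B : k ⊗[k] (B ⟶ B)) = r • x :=
  tensLift_app_id B _ r

theorem ofElement_comp {E E' : LinPsh a} {B : a} (x : E.obj.obj (.op B)) (g : E ⟶ E') :
    ofElement x ≫ g = ofElement (g.hom.app (.op B) x) := by
  refine tens_hom_ext B fun r => ?_
  rw [ofElement_app]
  change g.hom.app _ ((ofElement x).hom.app _ _) = _
  rw [ofElement_app, map_smul]

theorem ofElement_injective {E : LinPsh a} {B : a} {x y : E.obj.obj (.op B)}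
    (h : ofElement x = ofElement y) : x = y := by
  have := congrArg (fun t => t.hom.app (.op B) ((1 : k) ⊗ₜ[k] 𝟙 B : k ⊗[k] (B ⟶ B))) h
  simpa only [ofElement_app, one_smul] using this

theorem ofElement_add {E : LinPsh a} {B : a} (x y : E.obj.obj (.op B)) :
    ofElement (x + y) = ofElement x + ofElement y := by
  refine tens_hom_ext B fun r => ?_
  change _ = (ofElement x).hom.app (.op B) _ + (ofElement y).hom.app (.op B) _
  rw [ofElement_app, ofElement_app, ofElement_app, smul_add]

theorem ofElement_smul {E : LinPsh a} {B : a} (s : k) (x : E.obj.obj (.op B)) :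
    ofElement (s • x) = s • ofElement x := by
  refine tens_hom_ext B fun r => ?_
  change _ = s • (ofElement x).hom.app (.op B) _
  rw [ofElement_app, ofElement_app, smul_comm]

/-- The linear map sending an element of `E(B)` to the corresponding morphism. -/
noncomputable def ofElementₗ {E : LinPsh a} (B : a) :
    E.obj.obj (.op B) →ₗ[k] (tens k B ⟶ E) where
  toFun := ofElement
  map_add' := ofElement_add
  map_smul' := ofElement_smul

/-- Evaluation at an element of `T(B)`. -/
def evalAt {T E : LinPsh a} {B : a} (t : T.obj.obj (.op B)) :
    (T ⟶ E) →ₗ[k] E.obj.obj (.op B) where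
  toFun g := g.hom.app (.op B) t
  map_add' _ _ := rfl
  map_smul' _ _ := rfl

theorem exists_extension {E : LinPsh a} [Injective E] {B : a}
    (h : ∀ A : a, Module.Flat k (A ⟶ B)) {M N : Type v} [AddCommGroup M] [Module k M]
    [AddCommGroup N] [Module k N] {i : M →ₗ[k] N} (hi : Function.Injective i)
    (y : M →ₗ[k] E.obj.obj (.op B)) :
    ∃ x : N →ₗ[k] E.obj.obj (.op B), ∀ m, x (i m) = y m := by
  have := mono_tensMap B h hi
  let g := Injective.factorThru (tensLift y) (tensMap B i)
  refine ⟨(g.hom.app (.op B)).hom ∘ₗ (TensorProduct.mk k N (B ⟶ B)).flip (𝟙 B), fun m => ?_⟩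
  refine Eq.trans ?_ (tensLift_app_id B y m)
  rw [← Injective.comp_factorThru (tensLift y) (tensMap B i)]
  rfl

theorem exists_extension_ofElement {E T : LinPsh a} [Injective E] {B : a}
    (h : ∀ A : a, Module.Flat k (A ⟶ B)) {M N : Type v} [AddCommGroup M] [Module k M]
    [AddCommGroup N] [Module k N] {i : M →ₗ[k] N} (hi : Function.Injective i)
    (t : T.obj.obj (.op B)) (y : M →ₗ[k] (T ⟶ E)) :
    ∃ x : N →ₗ[k] (tens k B ⟶ E), ∀ m, x (i m) = ofElement t ≫ y m := by
  obtain ⟨x, hx⟩ := exists_extension (E := E) h hi ((evalAt t).comp y)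
  exact ⟨(ofElementₗ B).comp x, fun m =>
    (congrArg ofElement (hx m)).trans (ofElement_comp t (y m)).symm⟩

theorem isFlat [(KMod a).Grothendieck] (h : ∀ A B : a, Module.Flat k (A ⟶ B)) :
    (KMod a).IsFlat := by
  rw [KLinCat.isFlat_iff]
  intro E hE
  have hE' : Injective (C := LinPsh a) E := hE
  refine KLinCat.isCoflat_of_family.{v, v + 1, v, v} fun n K T y =>
    ⟨Σ B : a, (T : LinPsh a).obj.obj (.op B), fun i => tens k i.1, fun i => ofElement (a := a) i.2, fun {Z} f g hfg => ?_, fun i => ?_⟩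
  · refine linPsh_hom_ext (a := a) (F := T) (G := Z) fun B t => ofElement_injective ?_
    exact (ofElement_comp (a := a) t f).symm.trans
      ((hfg ⟨B, t⟩).trans (ofElement_comp (a := a) t g))
  · exact exists_extension_ofElement (a := a) (fun A => h A i.1) K.injective_subtype i.2 y

end KMod

theorem mainTheorem8 {k : Type v} [CommRing k] {X : Type v} [SemilatticeInf X] [Finite X] :
    -- prestacks of affine localizations
    (∀ C : KPrestack.{v, max u v} k X, C.IsAffineLocalization →
      (C.star.IsAffineLocalization ∧
        C.star.restrict = C ∧
        C.star.obj ⊤ = C.Des ∧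
        (∀ U : X, C.star.map (homOfLE le_top : (U : WithTop X) ⟶ ⊤) = C.proj U) ∧
        -- the base change formula, for all choices of right adjoints `u_{U,*}` and `u^V_{U ∩ V,*}`
        (∀ (U V : X) (R : C.obj U ⥤ C.Des) (adj : C.proj U ⊣ R)
          (R' : C.obj (U ⊓ V) ⥤ C.obj V)
          (adj' : C.map (homOfLE inf_le_right : U ⊓ V ⟶ V) ⊣ R'),
          IsIso (C.star.baseChange (Q := (U ⊓ V : X)) (V := (U : X)) (W := (V : X)) (U := ⊤)
            (w₁ := KPrestack.toCoe (homOfLE inf_le_left))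
            (v₁ := KPrestack.toCoe (homOfLE inf_le_right))
            (v := homOfLE le_top) (w := homOfLE le_top) ⟨rfl⟩ adj adj' :
              R ⋙ C.proj V ⟶ C.map (homOfLE inf_le_left : U ⊓ V ⟶ U) ⋙ R'))) ∧
      ((∀ U : X, (C.obj U).IsFlat) → C.Des.IsFlat)) ∧
    -- quasi-compact semi-separated prestacks
    (∀ A : KPrestack.{v, v} k X, A.IsSemiSeparated →
      ((KPrestack.star.{v, v + 1} A.mod).IsAffineLocalization ∧
        (KPrestack.star.{v, v + 1} A.mod).restrict = A.mod ∧
        (KPrestack.star.{v, v + 1} A.mod).obj ⊤ = A.Qch ∧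
        A.Qch.IsGrothendieck) ∧
      ((∀ (U : X) (B B' : A.obj U), Module.Flat k (B ⟶ B')) → A.Qch.IsFlat)) := by
  refine ⟨fun C hC => ⟨⟨hC.star, rfl, rfl, fun U => rfl, fun U V R adj R' adj' => ?_⟩,
    hC.isFlat_des⟩, fun A hA => ⟨⟨?_, rfl, rfl, ?_⟩, fun h => ?_⟩⟩
  · exact hC.isIso_baseChange_star (Q := (U ⊓ V : X)) (V := (U : X)) (W := (V : X)) (U := ⊤)
      (w₁ := KPrestack.toCoe (homOfLE inf_le_left)) (v₁ := KPrestack.toCoe (homOfLE inf_le_right))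
      (v := homOfLE le_top) (w := homOfLE le_top)
      (fun T h₁ h₂ => WithTop.coe_inf U V ▸ le_inf h₁ h₂) ⟨rfl⟩ (Rv := R) adj (Rv₁ := R') adj'
  · exact KPrestack.IsAffineLocalization.star.{v, v + 1} hA
  · exact KPrestack.IsAffineLocalization.isGrothendieck_des.{v, v + 1} hA
  · refine KPrestack.IsAffineLocalization.isFlat_des.{v, v + 1} hA fun U => ?_
    have : (KMod (A.obj U)).Grothendieck := ⟨hA.grothendieck U⟩
    exact KMod.isFlat (h U)
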